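/- Let $N\ge 1$ and $\eta>0$. A relaying chain with $N$ hops has levels $0,\dots,N$ with $k_0,\dots,k_N\ge 1$ antennas. The channel of hop $i\in\{1,\dots,N\}$ is ${\bf H}_i={\bf C}_{r,i}^{1/2}{\bf \Theta}_i{\bf C}_{t,i}^{1/2}$, where the correlation matrices ${\bf C}_{r,i}$ ($k_i\times k_i$) and ${\bf C}_{t,i}$ ($k_{i-1}\times k_{i-1}$) are positive semidefinite, and ${\bf \Theta}_1,\dots,{\bf \Theta}_N$ are independent, ${\bf \Theta}_i$ being $k_i\times k_{i-1}$ with i.i.d. circularly-symmetric complex Gaussian entries of mean $0$ and variance $1/k_i$. Given precoding matrices ${\bf P}_i\in\mathbb C^{k_i\times k_i}$, $0\le i\le N-1$, and a source signal ${\bf y}_0$ independent of the channels, with i.i.d. circularly-symmetric complex Gaussian entries of mean $0$ and ${\rm E}\{{\bf y}_0{\bf y}_0^H\}={\bf I}$, level $i$ transmits ${\bf x}_i={\bf P}_i{\bf y}_i$, where ${\bf y}_i={\bf H}_i{\bf x}_{i-1}$ for $1\le i\le N-1$. The precoders are feasible for budgets $\mathcal P_0,\dots,\mathcal P_{N-1}\ge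 0$ if ${\rm tr}({\rm E}\{{\bf x}_i{\bf x}_i^H\})\le\mathcal P_i$ for $0\le i\le N-1$. With ${\bf G}_N={\bf H}_N{\bf P}_{N-1}{\bf H}_{N-1}\cdots{\bf P}_1{\bf H}_1{\bf P}_0$, the instantaneous mutual information per dimension is $\mathcal I=\frac1{k_0}\log_2\det({\bf I}+\eta\,{\bf G}_N{\bf G}_N^H)$, and the average mutual information is ${\rm E}\{\mathcal I\}$. Let ${\bf C}_{t,i}={\bf U}_{t,i}{\bf \Lambda}_{t,i}{\bf U}_{t,i}^H$ and ${\bf C}_{r,i}={\bf U}_{r,i}{\bf \Lambda}_{r,i}{\bf U}_{r,i}^H$ ($1\le i\le N$) be eigenvalue decompositions with unitary ${\bf U}_{t,i},{\bf U}_{r,i}$ and with eigenvalues in decreasing order. Call precoders aligned if there are complex diagonal matrices ${\bf \Lambda}_{P_i}$ with $${\bf P}_0={\bf U}_{t,1}{\bf \Lambda}_{P_0},\qquad {\bf P}_i={\bf U}_{t,i+1}{\bf \Lambda}_{P_i}{\bf U}_{r,i}^H\quad(1\le i\le N-1).$$ (1) Finite size. There are feasible aligned precoders that maximize the average mutual information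 over all feasible precoders. (2) Asymptotic regime. Consider a sequence of such chains, indexed by $n$, with the same $N$ and $\eta$, with budgets and eigenvalue decompositions that may depend on $n$, and with $k_j(n)\to\infty$ and $k_j(n)/k_N(n)\to\rho_j\in\mathbb R$ for $0\le j\le N$. For a sequence of feasible precoders, say that its asymptotic mutual information is $L\in\mathbb R$ if (i) $\mathcal I\to L$ almost surely, systems of different sizes being sampled independently, or, as a second notion, if (ii) ${\rm E}\{\mathcal I\}\to L$. For each of the two notions: every value that is the asymptotic mutual information of a sequence of feasible precoders is reached or exceeded by that of a sequence of feasible aligned precoders; and if the set of these values is bounded above, it has a maximum, which is attained by a sequence of feasible aligned precoders. (3) Moreover, there is a sequence of feasible aligned precoders that maximizes the average mutual information at every finite size $n$ and is such that, whenever $L$ is the asymptotic mutual information of some sequence of feasible precoders (for either notion), the average mutual information per dimension of this sequence is eventually larger than every $c<L$. -/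

import Mathlib

open MeasureTheory ProbabilityTheory Filter Topology
open scoped Matrix NNReal ComplexOrder MatrixOrder

noncomputable section

/-- The circularly-symmetric complex Gaussian law with mean zero and `E |z|² = v`: real and
imaginary parts are independent real centred Gaussians of variance `v / 2`. -/
def complexGaussian (v : ℝ≥0) : Measure ℂ :=
  ((gaussianReal 0 (v / 2)).prod (gaussianReal 0 (v / 2))).map
    Complex.measurableEquivRealProd.symm

instance instProbComplexGaussian (v : ℝ≥0) : IsProbabilityMeasure (complexGaussian v) :=
  Measure.isProbabilityMeasure_map Complex.measurableEquivRealProd.symm.measurable.aemeasurable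

/-- A relaying chain with `N` hops, hence with levels `0, …, N`; level `j` has `k j` antennas.
Hop `i : Fin N` leads from level `i` (`i.castSucc`) to level `i + 1` (`i.succ`).
`Ct i` is the transmit correlation matrix `C_{t,i+1}` of the hop that starts at level `i`, and
`Cr j` is the receive correlation matrix `C_{r,j}` of the hop that ends at level `j`.
Level `0` does not receive anything: the entry `Cr 0` is never used and nothing is required of
it. -/
structure RelayChain (N : ℕ) where
  k : Fin (N + 1) → ℕ
  k_pos : ∀ j, 0 < k j
  Ct : ∀ i : Fin N, Matrix (Fin (k i.castSucc)) (Fin (k i.castSucc)) ℂ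
  Cr : ∀ j : Fin (N + 1), Matrix (Fin (k j)) (Fin (k j)) ℂ
  Ct_posSemidef : ∀ i : Fin N, (Ct i).PosSemidef
  Cr_posSemidef : ∀ i : Fin N, (Cr i.succ).PosSemidef

namespace RelayChain

variable {N : ℕ} (S : RelayChain N)

/-- Realizations of the white matrices `Θ_1, …, Θ_N`, written entrywise. -/
abbrev Sample : Type := ∀ i : Fin N, Fin (S.k i.succ) → Fin (S.k i.castSucc) → ℂ

/-- The joint law of the `Θ`'s: all the entries are independent, and those of the matrix of the hop
that ends at level `i + 1` are complex Gaussian with `E |θ|² = 1 / k_{i+1}`. -/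
def channelLaw : Measure S.Sample :=
  Measure.pi fun i : Fin N => Measure.pi fun _ => Measure.pi fun _ =>
    complexGaussian (1 / (S.k i.succ : ℝ≥0))

instance instProbChannelLaw : IsProbabilityMeasure S.channelLaw := by
  unfold channelLaw; infer_instance

/-- The Kronecker model `H = C_r^{1/2} Θ C_t^{1/2}`, with positive semidefinite square roots. -/
def channel (θ : S.Sample) (i : Fin N) :
    Matrix (Fin (S.k i.succ)) (Fin (S.k i.castSucc)) ℂ :=
  CFC.sqrt (S.Cr i.succ) * Matrix.of (θ i) * CFC.sqrt (S.Ct i)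

/-- A family of precoding matrices `P_0, …, P_{N-1}`. -/
abbrev Precoder : Type := ∀ i : Fin N, Matrix (Fin (S.k i.castSucc)) (Fin (S.k i.castSucc)) ℂ

/-- The matrix `G_j = H_j P_{j-1} ⋯ H_1 P_0` from the source signal `y_0` to level `j`. -/
def chain (P : S.Precoder) (θ : S.Sample) (j : Fin (N + 1)) :
    Matrix (Fin (S.k j)) (Fin (S.k 0)) ℂ :=
  Fin.induction (motive := fun j => Matrix (Fin (S.k j)) (Fin (S.k 0)) ℂ) 1
    (fun i G => S.channel θ i * P i * G) j

/-- Joint law of the channels and of the white source signal `y_0`, `E y_0 y_0ᴴ = I`. -/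
def signalLaw : Measure (S.Sample × (Fin (S.k 0) → ℂ)) :=
  S.channelLaw.prod (Measure.pi fun _ => complexGaussian 1)

/-- The signal `x_i = P_i y_i` sent by level `i`, where `y_i = G_i y_0` is received noiselessly. -/
def transmitted (P : S.Precoder) (i : Fin N) (ω : S.Sample × (Fin (S.k 0) → ℂ)) :
    Fin (S.k i.castSucc) → ℂ :=
  P i *ᵥ (S.chain P ω.1 i.castSucc *ᵥ ω.2)

/-- The covariance matrix `E {x_i x_iᴴ}`. -/
def txCovariance (P : S.Precoder) (i : Fin N) :
    Matrix (Fin (S.k i.castSucc)) (Fin (S.k i.castSucc)) ℂ :=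
  Matrix.of fun a b =>
    ∫ ω, S.transmitted P i ω a * star (S.transmitted P i ω b) ∂S.signalLaw

/-- The per-node average power constraints `tr (E {x_i x_iᴴ}) ≤ 𝒫_i`. -/
def Feasible (budget : Fin N → ℝ) (P : S.Precoder) : Prop :=
  ∀ i, (S.txCovariance P i).trace.re ≤ budget i

/-- The end-to-end instantaneous mutual information per dimension
`(1 / k_0) log₂ det (I + η G_N G_Nᴴ)`. -/
def instMI (η : ℝ) (P : S.Precoder) (θ : S.Sample) : ℝ :=
  1 / (S.k 0 : ℝ) *
    Real.logb 2 (1 + (η : ℂ) • (S.chain P θ (Fin.last N) * (S.chain P θ (Fin.last N))ᴴ)).det.re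

/-- The average mutual information (per dimension) of the finite-size system. -/
def averageMI (η : ℝ) (P : S.Precoder) : ℝ :=
  ∫ θ, S.instMI η P θ ∂S.channelLaw

/-- Eigenvalue decompositions `C = U Λ Uᴴ` of all the correlation matrices, with unitary `U` and
with the eigenvalues in decreasing order. (`Ur 0` and `lr 0` are never used.) -/
structure EigenFrame where
  Ut : ∀ i : Fin N, Matrix (Fin (S.k i.castSucc)) (Fin (S.k i.castSucc)) ℂ
  lt : ∀ i : Fin N, Fin (S.k i.castSucc) → ℝ
  Ur : ∀ j : Fin (N + 1), Matrix (Fin (S.k j)) (Fin (S.k j)) ℂ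
  lr : ∀ j : Fin (N + 1), Fin (S.k j) → ℝ
  Ut_unitary : ∀ i, Ut i ∈ Matrix.unitaryGroup (Fin (S.k i.castSucc)) ℂ
  Ur_unitary : ∀ i : Fin N, Ur i.succ ∈ Matrix.unitaryGroup (Fin (S.k i.succ)) ℂ
  lt_antitone : ∀ i, Antitone (lt i)
  lr_antitone : ∀ i : Fin N, Antitone (lr i.succ)
  Ct_eq : ∀ i, S.Ct i = Ut i * Matrix.diagonal (fun a => (lt i a : ℂ)) * (Ut i)ᴴ
  Cr_eq : ∀ i : Fin N,
    S.Cr i.succ = Ur i.succ * Matrix.diagonal (fun a => (lr i.succ a : ℂ)) * (Ur i.succ)ᴴ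

variable {S}

/-- The precoders have the form `P_0 = U_{t,1} Λ_{P_0}` and `P_i = U_{t,i+1} Λ_{P_i} U_{r,i}ᴴ` for
`1 ≤ i ≤ N - 1`, with complex diagonal matrices `Λ_{P_i}`. -/
def Aligned (E : S.EigenFrame) (P : S.Precoder) : Prop :=
  ∃ d : ∀ i : Fin N, Fin (S.k i.castSucc) → ℂ, ∀ i : Fin N,
    ((i : ℕ) = 0 → P i = E.Ut i * Matrix.diagonal (d i)) ∧
    ((i : ℕ) ≠ 0 → P i = E.Ut i * Matrix.diagonal (d i) * (E.Ur i.castSucc)ᴴ)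

end RelayChain

/-- The instantaneous mutual information per dimension of the systems `S n` with precoders `P n`
converges to the constant `L` almost surely, the systems being sampled independently of each
other. -/
def HasAsymptoticMI {N : ℕ} (S : ℕ → RelayChain N) (η : ℝ) (P : ∀ n, (S n).Precoder) (L : ℝ) :
    Prop :=
  ∀ᵐ θ ∂(Measure.infinitePi fun n => (S n).channelLaw),
    Tendsto (fun n => (S n).instMI η (P n) (θ n)) atTop (𝓝 L)

/-- The average mutual information per dimension converges to `L`. -/
def HasAsymptoticAverageMI {N : ℕ} (S : ℕ → RelayChain N) (η : ℝ) (P : ∀ n, (S n).Precoder)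
    (L : ℝ) : Prop :=
  Tendsto (fun n => (S n).averageMI η (P n)) atTop (𝓝 L)

/-- The values that are attained, in the sense of the notion `A` of asymptotic mutual information,
by sequences of precoders that respect the power constraints. -/
def attainableMI {N : ℕ} (S : ℕ → RelayChain N) (budget : ℕ → Fin N → ℝ)
    (A : (∀ n, (S n).Precoder) → ℝ → Prop) : Set ℝ :=
  {L | ∃ P : ∀ n, (S n).Precoder, (∀ n, (S n).Feasible (budget n) (P n)) ∧ A P L}

/-- The values that are attained by such sequences of precoders of the aligned form. -/
def alignedMI {N : ℕ} (S : ℕ → RelayChain N) (budget : ℕ → Fin N → ℝ)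
    (E : ∀ n, (S n).EigenFrame) (A : (∀ n, (S n).Precoder) → ℝ → Prop) : Set ℝ :=
  {L | ∃ P : ∀ n, (S n).Precoder, (∀ n, (S n).Feasible (budget n) (P n)) ∧
    (∀ n, RelayChain.Aligned (E n) (P n)) ∧ A P L}

/-- Aligned precoders are optimal for the notion `A` of asymptotic mutual information: every
attainable value is reached or exceeded by an aligned sequence, and if the attainable values are
bounded above (without which there is no optimum), their maximum exists and is attained by an
aligned sequence. -/
def AlignedOptimal {N : ℕ} (S : ℕ → RelayChain N) (budget : ℕ → Fin N → ℝ)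
    (E : ∀ n, (S n).EigenFrame) (A : (∀ n, (S n).Precoder) → ℝ → Prop) : Prop :=
  (∀ L ∈ attainableMI S budget A, ∃ L' ∈ alignedMI S budget E A, L ≤ L') ∧
  (BddAbove (attainableMI S budget A) →
    ∃ L ∈ alignedMI S budget E A, IsGreatest (attainableMI S budget A) L)

end

/-! Absorb the correlation roots into the precoders: with A_i = C_t^{1/2} P_i C_r^{1/2} (`mid`; no
receive root at the source), the end-to-end matrix is C_r^{1/2} Θ_N A_{N-1} ⋯ Θ_1 A_0. Each Θ_i is
bi-unitarily invariant and log det ignores a unitary factor on the right, so the law of the mutual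
information depends only on the singular values of the A_i (`map_instMI_eq`). Integrating the Θ's
out one at a time shows that level i spends a product of the quantities ‖A_l‖²/k_{l+1}, l < i, times
‖P_i C_r^{1/2}‖² in Frobenius norm (`trace_txCovariance`). The product is again a function of
singular values; only the last factor depends on the singular vectors.

The question thus decouples into one-hop problems: for diagonal T, R with decreasing entries and
prescribed singular values σ of TQR, make ‖QR‖² small. The squared row norms of TQR are the image of
σ² under a doubly stochastic matrix, so Birkhoff's theorem and the rearrangement inequality give
‖QR‖² ≥ ∑ σ_j²/t_j², with equality for the diagonal Q = σ/(tr) (`exists_aligned_diagonal`). Hence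
every precoder has an aligned counterpart with the same law and no more power at any level
(`exists_aligned_same_law`).

A maximizer then exists by compactness. The feasible set itself may be unbounded, since weak early
precoders let later ones be huge, but rescaling to spend each budget exactly does not decrease the
mutual information, and the aligned diagonals with exact budgets, set to zero where they act on
nothing, form a compact set (`isCompact_fullPower`).

Asymptotically, equality of laws at each size transfers both kinds of limit to aligned sequences, a
diagonal argument attains the supremum of the values, and truncated dominated convergence compares
almost sure limits with averages. -/

noncomputable section

/-! ### Frobenius norms -/

section Frobenius

variable {ι κ τ : Type*} [Fintype ι] [Fintype κ] [Fintype τ]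

/-- The squared Frobenius norm of a complex matrix. -/
def frobSq (M : Matrix ι κ ℂ) : ℝ := ∑ a, ∑ b, ‖M a b‖ ^ 2

lemma frobSq_nonneg (M : Matrix ι κ ℂ) : 0 ≤ frobSq M := by
  unfold frobSq; positivity

lemma frobSq_eq_trace (M : Matrix ι κ ℂ) : ((frobSq M : ℝ) : ℂ) = (M * Mᴴ).trace := by
  simp [frobSq, Matrix.trace, Matrix.mul_apply, Complex.mul_conj, Complex.normSq_eq_norm_sq]

lemma frobSq_eq_trace_re (M : Matrix ι κ ℂ) : frobSq M = (M * Mᴴ).trace.re := by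
  rw [← frobSq_eq_trace, Complex.ofReal_re]

lemma frobSq_conjTranspose (M : Matrix ι κ ℂ) : frobSq Mᴴ = frobSq M := by
  unfold frobSq
  rw [Finset.sum_comm]
  simp

lemma frobSq_eq_zero_iff {M : Matrix ι κ ℂ} : frobSq M = 0 ↔ M = 0 := by
  constructor
  · intro h
    ext a b
    have h1 := (Finset.sum_eq_zero_iff_of_nonneg (fun a _ => by positivity)).1 h a
      (Finset.mem_univ _)
    have h2 := (Finset.sum_eq_zero_iff_of_nonneg (fun a _ => by positivity)).1 h1 b
      (Finset.mem_univ _)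
    simpa using h2
  · rintro rfl
    simp [frobSq]

lemma frobSq_smul (c : ℂ) (M : Matrix ι κ ℂ) : frobSq (c • M) = ‖c‖ ^ 2 * frobSq M := by
  simp [frobSq, mul_pow, Finset.mul_sum]

lemma frobSq_mul_le (M : Matrix ι κ ℂ) (L : Matrix κ τ ℂ) :
    frobSq (M * L) ≤ frobSq M * frobSq L := by
  have h : ∀ a c, ‖(M * L) a c‖ ^ 2 ≤ (∑ b, ‖M a b‖ ^ 2) * ∑ b, ‖L b c‖ ^ 2 := by
    intro a c
    refine le_trans ?_ (Finset.sum_mul_sq_le_sq_mul_sq _ _ _)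
    gcongr
    rw [Matrix.mul_apply]
    exact (norm_sum_le _ _).trans_eq (by simp)
  calc frobSq (M * L) ≤ ∑ a, ∑ c, (∑ b, ‖M a b‖ ^ 2) * ∑ b, ‖L b c‖ ^ 2 :=
        Finset.sum_le_sum fun a _ => Finset.sum_le_sum fun c _ => h a c
    _ = frobSq M * frobSq L := by
        simp only [frobSq]
        rw [Finset.sum_comm (f := fun b c => ‖L b c‖ ^ 2), Finset.sum_mul_sum]

lemma frobSq_diagonal [DecidableEq ι] (d : ι → ℂ) :
    frobSq (Matrix.diagonal d) = ∑ a, ‖d a‖ ^ 2 := by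
  unfold frobSq
  refine Finset.sum_congr rfl fun a _ => ?_
  rw [Finset.sum_eq_single a] <;> simp +contextual [eq_comm]

lemma frobSq_unitary_mul [DecidableEq ι] {U : Matrix ι ι ℂ} (hU : U ∈ Matrix.unitaryGroup ι ℂ)
    (M : Matrix ι κ ℂ) : frobSq (U * M) = frobSq M := by
  rw [frobSq_eq_trace_re, frobSq_eq_trace_re, Matrix.conjTranspose_mul, Matrix.mul_assoc,
    Matrix.trace_mul_comm, Matrix.mul_assoc, Matrix.mul_assoc]
  have : Uᴴ * U = 1 := Matrix.mem_unitaryGroup_iff'.1 hU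
  rw [this, Matrix.mul_one]

lemma frobSq_mul_unitary [DecidableEq κ] {U : Matrix κ κ ℂ} (hU : U ∈ Matrix.unitaryGroup κ ℂ)
    (M : Matrix ι κ ℂ) : frobSq (M * U) = frobSq M := by
  rw [← frobSq_conjTranspose, Matrix.conjTranspose_mul,
    ← Matrix.star_eq_conjTranspose U, frobSq_unitary_mul (Unitary.star_mem hU),
    frobSq_conjTranspose]

lemma continuous_frobSq : Continuous (frobSq : Matrix ι κ ℂ → ℝ) := by
  unfold frobSq; fun_prop

end Frobenius

/-! ### Unitary invariance of complex Gaussian matrices -/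

section Gaussian

lemma complexGaussian_map (v : ℝ≥0) :
    complexGaussian v = ((gaussianReal 0 (v / 2)).prod (gaussianReal 0 (v / 2))).map
      (fun p => (p.1 : ℂ) + p.2 * Complex.I) := by
  unfold complexGaussian
  congr 1
  funext p
  apply Complex.ext <;> simp [Complex.measurableEquivRealProd]

lemma charFun_complexGaussian (v : ℝ≥0) (t : ℂ) :
    charFun (complexGaussian v) t = Complex.exp (-(v * ‖t‖ ^ 2 / 4 : ℝ)) := by
  have hm : Measurable (fun p : ℝ × ℝ => (p.1 : ℂ) + p.2 * Complex.I) := by fun_prop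
  rw [complexGaussian_map, charFun_apply, integral_map hm.aemeasurable (by fun_prop)]
  have h : ∀ p : ℝ × ℝ, Complex.exp ((inner ℝ ((p.1 : ℂ) + p.2 * Complex.I) t : ℝ) * Complex.I)
      = Complex.exp (t.re * p.1 * Complex.I) * Complex.exp (t.im * p.2 * Complex.I) := by
    intro p
    rw [← Complex.exp_add]
    congr 1
    rw [Complex.inner]
    simp
    ring
  simp_rw [h]
  rw [integral_prod_mul (fun x : ℝ => Complex.exp (t.re * x * Complex.I))
    (fun x : ℝ => Complex.exp (t.im * x * Complex.I)), ← charFun_apply_real, ← charFun_apply_real,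
    charFun_gaussianReal, charFun_gaussianReal, ← Complex.exp_add]
  congr 1
  have : ‖t‖ ^ 2 = t.re ^ 2 + t.im ^ 2 := by
    rw [← Complex.normSq_eq_norm_sq, Complex.normSq_apply]; ring
  rw [this]
  push_cast
  ring

lemma charFun_pi_complexGaussian {ι : Type*} [Fintype ι] (v : ℝ≥0)
    (t : PiLp 2 (fun _ : ι => ℂ)) :
    charFun ((Measure.pi fun _ : ι => complexGaussian v).map (WithLp.toLp 2)) t =
      Complex.exp (-(v * ‖t‖ ^ 2 / 4 : ℝ)) := by
  rw [charFun_pi]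
  simp_rw [charFun_complexGaussian]
  rw [← Complex.exp_sum]
  congr 1
  rw [PiLp.norm_sq_eq_of_L2]
  push_cast
  rw [Finset.sum_neg_distrib, Finset.mul_sum, Finset.sum_div]

/-- The characteristic function of the white Gaussian vector depends only on the Euclidean norm of
its argument, hence the law is fixed by every real-linear isometry. -/
lemma measurePreserving_pi_complexGaussian {ι : Type*} [Fintype ι] (v : ℝ≥0)
    (T : (ι → ℂ) →ₗ[ℝ] (ι → ℂ)) (hT : ∀ x, ∑ i, ‖T x i‖ ^ 2 = ∑ i, ‖x i‖ ^ 2) :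
    MeasurePreserving T (Measure.pi fun _ : ι => complexGaussian v)
      (Measure.pi fun _ : ι => complexGaussian v) := by
  set μ := Measure.pi fun _ : ι => complexGaussian v
  have hTm : Measurable T := (LinearMap.continuous_of_finiteDimensional T).measurable
  refine ⟨hTm, ?_⟩
  let e := WithLp.linearEquiv 2 ℝ (ι → ℂ)
  let F₀ : PiLp 2 (fun _ : ι => ℂ) →ₗᵢ[ℝ] PiLp 2 (fun _ : ι => ℂ) :=
    ⟨e.symm.toLinearMap ∘ₗ T ∘ₗ e.toLinearMap, fun x => by
      rw [← sq_eq_sq₀ (norm_nonneg _) (norm_nonneg _), PiLp.norm_sq_eq_of_L2,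
        PiLp.norm_sq_eq_of_L2]
      exact hT _⟩
  let F := F₀.toLinearIsometryEquiv rfl
  have hFT : ∀ x, F (WithLp.toLp 2 x) = WithLp.toLp 2 (T x) := fun x => rfl
  have hlp : Measurable (WithLp.toLp 2 : (ι → ℂ) → PiLp 2 (fun _ : ι => ℂ)) := by fun_prop
  have key : (μ.map T).map (WithLp.toLp 2 : (ι → ℂ) → PiLp 2 (fun _ : ι => ℂ)) =
      μ.map (WithLp.toLp 2) := by
    have : IsProbabilityMeasure (μ.map T) := Measure.isProbabilityMeasure_map hTm.aemeasurable
    have := Measure.isProbabilityMeasure_map (μ := μ.map T) hlp.aemeasurable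
    have := Measure.isProbabilityMeasure_map (μ := μ) hlp.aemeasurable
    apply Measure.ext_of_charFun
    funext t
    rw [charFun_pi_complexGaussian, Measure.map_map hlp hTm]
    have : ((WithLp.toLp 2 : (ι → ℂ) → PiLp 2 (fun _ : ι => ℂ)) ∘ T) = F ∘ WithLp.toLp 2 := by
      funext x; exact (hFT x).symm
    rw [this, ← Measure.map_map F.continuous.measurable hlp, charFun_apply,
      integral_map F.continuous.measurable.aemeasurable (by fun_prop)]
    -- The isometry moves to the other side of the inner product, where its inverse keeps the norm
    -- of `t`.
    have h2 : ∀ x, inner ℝ (F x) t = inner ℝ x (F.symm t) := by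
      intro x
      rw [← F.inner_map_map x (F.symm t), F.apply_symm_apply]
    simp_rw [h2]
    rw [← charFun_apply, charFun_pi_complexGaussian, F.symm.norm_map]
  have hof : Measurable (WithLp.ofLp : PiLp 2 (fun _ : ι => ℂ) → (ι → ℂ)) := by fun_prop
  have := congrArg (Measure.map (WithLp.ofLp)) key
  rw [Measure.map_map hof hlp, Measure.map_map hof hlp] at this
  simpa [Function.comp_def] using this

lemma measurePreserving_curry_complexGaussian (v : ℝ≥0) (m n : ℕ) :
    MeasurePreserving (Function.curry : (Fin m × Fin n → ℂ) → _)
      (Measure.pi fun _ : Fin m × Fin n => complexGaussian v)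
      (Measure.pi fun _ : Fin m => Measure.pi fun _ : Fin n => complexGaussian v) := by
  refine ⟨by fun_prop, ?_⟩
  have := Measure.infinitePi_map_curry (fun (_ : Fin m) (_ : Fin n) => complexGaussian v)
  simp only [Measure.infinitePi_eq_pi] at this
  exact this

/-- The law of a matrix with i.i.d. complex Gaussian entries is bi-unitarily invariant. -/
lemma measurePreserving_unitary_mul_mul {m n : ℕ} (v : ℝ≥0)
    {X : Matrix (Fin m) (Fin m) ℂ} {Y : Matrix (Fin n) (Fin n) ℂ}
    (hX : X ∈ Matrix.unitaryGroup (Fin m) ℂ) (hY : Y ∈ Matrix.unitaryGroup (Fin n) ℂ) :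
    MeasurePreserving (fun (θ : Fin m → Fin n → ℂ) a b => (X * Matrix.of θ * Y) a b)
      (Measure.pi fun _ => Measure.pi fun _ => complexGaussian v)
      (Measure.pi fun _ => Measure.pi fun _ => complexGaussian v) := by
  let T : (Fin m × Fin n → ℂ) →ₗ[ℝ] (Fin m × Fin n → ℂ) :=
    { toFun := fun x p => (X * Matrix.of (Function.curry x) * Y) p.1 p.2
      map_add' := fun x y => by
        funext p
        have : Matrix.of (Function.curry (x + y)) =
            Matrix.of (Function.curry x) + Matrix.of (Function.curry y) := rfl
        rw [this, Matrix.mul_add, Matrix.add_mul]; rfl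
      map_smul' := fun c x => by
        funext p
        have : Matrix.of (Function.curry (c • x)) = c • Matrix.of (Function.curry x) := rfl
        rw [this, Matrix.mul_smul, Matrix.smul_mul]; rfl }
  have hT : ∀ x, ∑ i, ‖T x i‖ ^ 2 = ∑ i, ‖x i‖ ^ 2 := by
    intro x
    rw [Fintype.sum_prod_type, Fintype.sum_prod_type]
    change frobSq (X * Matrix.of (Function.curry x) * Y) = frobSq (Matrix.of (Function.curry x))
    rw [frobSq_mul_unitary hY, frobSq_unitary_mul hX]
  have h1 := measurePreserving_pi_complexGaussian v T hT
  have h2 := measurePreserving_curry_complexGaussian v m n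
  have hm : Measurable (fun (θ : Fin m → Fin n → ℂ) a b => (X * Matrix.of θ * Y) a b) := by
    simp only [Matrix.mul_apply, Matrix.of_apply]
    fun_prop
  refine ⟨hm, ?_⟩
  have h3 := (h2.comp h1).map_eq
  rw [← h2.map_eq, Measure.map_map hm h2.measurable]
  rw [h2.map_eq]
  exact h3

end Gaussian

/-! ### Singular values and the one-hop problem -/

section SingularValues

/-- Singular value decomposition of a square matrix, with decreasing singular values. -/
lemma exists_svd {n : ℕ} (A : Matrix (Fin n) (Fin n) ℂ) :
    ∃ (U V : Matrix (Fin n) (Fin n) ℂ) (σ : Fin n → ℝ), U ∈ Matrix.unitaryGroup (Fin n) ℂ ∧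
      V ∈ Matrix.unitaryGroup (Fin n) ℂ ∧ Antitone σ ∧ (∀ i, 0 ≤ σ i) ∧
      A = U * Matrix.diagonal (fun i => (σ i : ℂ)) * Vᴴ := by
  let E := EuclideanSpace ℂ (Fin n)
  let L : E →ₗ[ℂ] E := Matrix.toEuclideanLin A
  have hn : Module.finrank ℂ E = n := by simp [E]
  -- The right singular vectors are an eigenbasis of `L* L`. The left ones are the normalized images
  -- where `σ ≠ 0`, completed to an orthonormal basis.
  have hT := L.isSymmetric_adjoint_comp_self
  let v := hT.eigenvectorBasis hn
  let l := hT.eigenvalues hn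
  have hl : ∀ i, 0 ≤ l i := L.isPositive_adjoint_comp_self.nonneg_eigenvalues hn
  have hin : ∀ i j, inner ℂ (L (v i)) (L (v j)) = (l j : ℂ) * inner ℂ (v i) (v j) := by
    intro i j
    rw [← LinearMap.adjoint_inner_right]
    have := hT.apply_eigenvectorBasis hn j
    rw [LinearMap.comp_apply] at this
    rw [this, inner_smul_right]
    rfl
  let σ : Fin n → ℝ := fun i => √(l i)
  let s : Set (Fin n) := {i | σ i ≠ 0}
  let w : Fin n → E := fun i => ((σ i)⁻¹ : ℂ) • L (v i)
  have hσ2 : ∀ i, (σ i : ℂ) * σ i = l i := fun i => by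
    rw [← Complex.ofReal_mul, Real.mul_self_sqrt (hl i)]
  have hw : Orthonormal ℂ (s.domRestrict w) := by
    rw [orthonormal_iff_ite]
    rintro ⟨i, hi⟩ ⟨j, hj⟩
    simp only [Set.domRestrict_apply, w, inner_smul_left, inner_smul_right, hin,
      orthonormal_iff_ite.1 v.orthonormal i j, Subtype.mk.injEq]
    by_cases hij : i = j
    · subst hij
      have : (σ i : ℂ) ≠ 0 := Complex.ofReal_ne_zero.2 hi
      rw [← hσ2]
      simp
      field_simp
    · simp [hij]
  obtain ⟨b, hb⟩ := hw.exists_orthonormalBasis_extension_of_card_eq (by simp [E])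
  have hLv : ∀ j, L (v j) = (σ j : ℂ) • b j := by
    intro j
    by_cases hj : σ j = 0
    · have : l j = 0 := by
        have := hσ2 j
        rw [hj] at this
        simpa using this.symm
      have h0 : inner ℂ (L (v j)) (L (v j)) = 0 := by rw [hin, this]; simp
      rw [inner_self_eq_zero.1 h0, hj]
      simp
    · rw [hb j hj]
      simp only [w, smul_smul]
      rw [mul_inv_cancel₀ (Complex.ofReal_ne_zero.2 hj), one_smul]
  have hun : ∀ c : OrthonormalBasis (Fin n) ℂ E,
      Matrix.of (fun a j => c j a) ∈ Matrix.unitaryGroup (Fin n) ℂ := by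
    intro c
    rw [Matrix.mem_unitaryGroup_iff']
    ext i j
    rw [Matrix.one_apply, ← orthonormal_iff_ite.1 c.orthonormal i j, Matrix.mul_apply,
      PiLp.inner_apply]
    refine Finset.sum_congr rfl fun a _ => ?_
    simp [Matrix.star_apply, mul_comm]
  refine ⟨_, _, σ, hun b, hun v, fun i j hij => Real.sqrt_le_sqrt (hT.eigenvalues_antitone hn hij),
    fun i => Real.sqrt_nonneg _, ?_⟩
  have hAV : A * Matrix.of (fun a j => v j a) =
      Matrix.of (fun a j => b j a) * Matrix.diagonal (fun i => (σ i : ℂ)) := by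
    ext a j
    have := congrArg (fun x : E => x a) (hLv j)
    rw [Matrix.mul_diagonal, Matrix.of_apply, mul_comm]
    exact this
  rw [← hAV, Matrix.mul_assoc, ← Matrix.star_eq_conjTranspose,
    Matrix.mem_unitaryGroup_iff.1 (hun v), Matrix.mul_one]

/-- By Birkhoff's theorem `D` is a convex combination of permutation matrices, and for each
permutation this is the rearrangement inequality. -/
lemma sum_mul_le_sum_doublyStochastic {ι : Type*} [Fintype ι] [DecidableEq ι] {D : Matrix ι ι ℝ}
    (hD : D ∈ doublyStochastic ℝ ι) {w s : ι → ℝ} (h : Antivary w s) :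
    ∑ i, w i * s i ≤ ∑ i, w i * ∑ j, D i j * s j := by
  obtain ⟨c, hc, hc1, rfl⟩ := exists_eq_sum_perm_of_mem_doublyStochastic hD
  have : ∑ i, w i * ∑ j, (∑ σ, c σ • σ.permMatrix ℝ) i j * s j =
      ∑ σ : Equiv.Perm ι, c σ * ∑ i, w i * s (σ i) := by
    simp only [Matrix.sum_apply, Matrix.smul_apply, smul_eq_mul, Finset.mul_sum, Finset.sum_mul]
    rw [Finset.sum_comm]
    have h1 : ∀ j, ∑ x, ∑ i, w x * (c i * Equiv.Perm.permMatrix ℝ i x j * s j) =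
      ∑ i, ∑ x, w x * (c i * Equiv.Perm.permMatrix ℝ i x j * s j) := fun j => Finset.sum_comm
    simp_rw [h1]
    rw [Finset.sum_comm]
    refine Finset.sum_congr rfl fun σ _ => ?_
    rw [Finset.sum_comm]
    refine Finset.sum_congr rfl fun i _ => ?_
    rw [Finset.sum_eq_single (σ i)]
    · simp [Equiv.Perm.permMatrix, PEquiv.toMatrix_apply]; ring
    · intro j _ hj
      simp [Equiv.Perm.permMatrix, PEquiv.toMatrix_apply, hj.symm]
    · simp
  rw [this]
  calc ∑ i, w i * s i = ∑ σ : Equiv.Perm ι, c σ * ∑ i, w i * s i := by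
        rw [← Finset.sum_mul, hc1, one_mul]
    _ ≤ _ := Finset.sum_le_sum fun σ _ =>
        mul_le_mul_of_nonneg_left h.sum_mul_le_sum_mul_comp_perm (hc σ)

lemma sq_norm_unitary_mem_doublyStochastic {ι : Type*} [Fintype ι] [DecidableEq ι]
    {U : Matrix ι ι ℂ} (hU : U ∈ Matrix.unitaryGroup ι ℂ) :
    Matrix.of (fun i j => ‖U i j‖ ^ 2) ∈ doublyStochastic ℝ ι := by
  rw [mem_doublyStochastic_iff_sum]
  refine ⟨fun i j => by simp, fun i => ?_, fun j => ?_⟩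
  · have := congrFun (congrFun (Matrix.mem_unitaryGroup_iff.1 hU) i) i
    simp only [Matrix.mul_apply, Matrix.star_apply, RCLike.star_def, Complex.mul_conj,
      Complex.normSq_eq_norm_sq, Matrix.one_apply_eq] at this
    exact_mod_cast this
  · have := congrFun (congrFun (Matrix.mem_unitaryGroup_iff'.1 hU) j) j
    simp only [Matrix.mul_apply, Matrix.star_apply, RCLike.star_def, mul_comm, Complex.mul_conj,
      Complex.normSq_eq_norm_sq, Matrix.one_apply_eq] at this
    exact_mod_cast this

/-- If `diag(t) B` has singular values `σ`, then `σ` vanishes where `t` does, and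
`∑ σ² / t² ≤ ‖B‖²`. -/
lemma singular_values_diagonal_mul {n : ℕ} {t σ : Fin n → ℝ} {B U V : Matrix (Fin n) (Fin n) ℂ}
    (ht : Antitone t) (ht0 : ∀ i, 0 ≤ t i) (hσ : Antitone σ) (hσ0 : ∀ i, 0 ≤ σ i)
    (hU : U ∈ Matrix.unitaryGroup (Fin n) ℂ) (hV : V ∈ Matrix.unitaryGroup (Fin n) ℂ)
    (h : Matrix.diagonal (fun i => (t i : ℂ)) * B =
      U * Matrix.diagonal (fun i => (σ i : ℂ)) * Vᴴ) :
    (∀ j, t j = 0 → σ j = 0) ∧ ∑ j, σ j ^ 2 / t j ^ 2 ≤ frobSq B := by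
  set A := Matrix.diagonal (fun i => (t i : ℂ)) * B with hA
  -- Right multiplication by `Vᴴ` keeps the norm of each row, so the squared row norms of `A` are
  -- the image of `σ²` under the doubly stochastic matrix `|U i j|²`.
  have hrow : ∀ i, ∑ b, ‖A i b‖ ^ 2 = ∑ j, ‖U i j‖ ^ 2 * σ j ^ 2 := by
    intro i
    have hVs : Vᴴ ∈ Matrix.unitaryGroup (Fin n) ℂ := Unitary.star_mem hV
    have h1 := frobSq_mul_unitary hVs
      (Matrix.of fun (_ : Unit) j => (U * Matrix.diagonal (fun i => (σ i : ℂ))) i j)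
    have h2 : (Matrix.of fun (_ : Unit) j => (U * Matrix.diagonal (fun i => (σ i : ℂ))) i j) * Vᴴ =
        Matrix.of fun (_ : Unit) j => A i j := by
      rw [h]; rfl
    rw [h2] at h1
    simpa [frobSq, mul_pow] using h1
  have hArow : ∀ i b, ‖A i b‖ ^ 2 = t i ^ 2 * ‖B i b‖ ^ 2 := by
    intro i b
    rw [hA, Matrix.diagonal_mul, norm_mul, mul_pow]
    simp
  -- Where `t` vanishes the weight `1 / t²` is replaced by any `M` dominating the other weights: the
  -- weights stay increasing, and they cost nothing there because that row of `A` is zero.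
  have main : ∀ M : ℝ, (∀ i, t i ≠ 0 → 1 / t i ^ 2 ≤ M) →
      ∑ j, (if t j = 0 then M else 1 / t j ^ 2) * σ j ^ 2 ≤ frobSq B := by
    intro M hM
    have hav : Antivary (fun j => if t j = 0 then M else 1 / t j ^ 2) (fun j => σ j ^ 2) := by
      refine Monotone.antivary (fun i j hij => ?_) (fun i j hij => ?_)
      · have := ht hij
        have h0 := ht0 j
        split_ifs with h1 h2 h2
        · exact le_rfl
        · exact absurd (le_antisymm (h1 ▸ this) h0) h2
        · exact hM i h1
        · have : 0 < t j := lt_of_le_of_ne h0 (Ne.symm h2)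
          gcongr
      · exact pow_le_pow_left₀ (hσ0 j) (hσ hij) 2
    refine (sum_mul_le_sum_doublyStochastic (sq_norm_unitary_mem_doublyStochastic hU) hav).trans ?_
    refine Finset.sum_le_sum fun i _ => ?_
    simp only [Matrix.of_apply]
    rw [← hrow]
    simp_rw [hArow]
    split_ifs with h1
    · simp [h1]; positivity
    · rw [← Finset.mul_sum, ← mul_assoc, one_div_mul_cancel (pow_ne_zero 2 h1), one_mul]
  obtain ⟨M₀, hM₀⟩ : ∃ M₀ : ℝ, ∀ i, t i ≠ 0 → 1 / t i ^ 2 ≤ M₀ :=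
    ⟨∑ i, 1 / t i ^ 2, fun i _ =>
      Finset.single_le_sum (f := fun i => 1 / t i ^ 2) (fun i _ => by positivity)
        (Finset.mem_univ i)⟩
  have hzero : ∀ j, t j = 0 → σ j = 0 := by
    intro j hj
    by_contra hne
    have hpos : 0 < σ j ^ 2 := by positivity
    -- Large enough that the single term at `j` already exceeds `frobSq B`.
    set M := max (max M₀ 0) ((frobSq B + 1) / σ j ^ 2)
    have h1 := main M fun i hi => (hM₀ i hi).trans ((le_max_left _ _).trans (le_max_left _ _))
    have hM0 : 0 ≤ M := (le_max_right _ _).trans (le_max_left _ _)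
    have h2 := Finset.single_le_sum
      (f := fun j => (if t j = 0 then M else 1 / t j ^ 2) * σ j ^ 2)
      (fun i _ => by split_ifs <;> positivity) (Finset.mem_univ j)
    simp only [hj, if_true] at h2
    have h3 : (frobSq B + 1) / σ j ^ 2 * σ j ^ 2 ≤ M * σ j ^ 2 := by
      gcongr
      exact le_max_right _ _
    rw [div_mul_cancel₀ _ hpos.ne'] at h3
    linarith
  -- Where `t j = 0` the convention `x / 0 = 0` agrees with the weighted term, since `σ j = 0`.
  refine ⟨hzero, le_trans (le_of_eq ?_) (main M₀ hM₀)⟩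
  refine Finset.sum_congr rfl fun j _ => ?_
  split_ifs with h1
  · simp [hzero j h1]
  · ring

/-- One-hop alignment: the matrix `diag(t) Q diag(r)` has the singular values `t d r` for some `d`
whose cost `∑ d² r²` is at most that of `Q`. -/
lemma exists_aligned_diagonal {n : ℕ} {t r : Fin n → ℝ} (ht : Antitone t) (ht0 : ∀ i, 0 ≤ t i)
    (hr : Antitone r) (hr0 : ∀ i, 0 ≤ r i) (Q : Matrix (Fin n) (Fin n) ℂ) :
    ∃ (U V : Matrix (Fin n) (Fin n) ℂ) (d : Fin n → ℝ), U ∈ Matrix.unitaryGroup (Fin n) ℂ ∧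
      V ∈ Matrix.unitaryGroup (Fin n) ℂ ∧ (∀ j, t j * r j = 0 → d j = 0) ∧
      Matrix.diagonal (fun i => (t i : ℂ)) * Q * Matrix.diagonal (fun i => (r i : ℂ)) =
        U * Matrix.diagonal (fun i => ((t i * d i * r i : ℝ) : ℂ)) * Vᴴ ∧
      ∑ j, (d j * r j) ^ 2 ≤ frobSq (Q * Matrix.diagonal (fun i => (r i : ℂ))) := by
  obtain ⟨U, V, σ, hU, hV, hσ, hσ0, h⟩ := exists_svd
    (Matrix.diagonal (fun i => (t i : ℂ)) * Q * Matrix.diagonal (fun i => (r i : ℂ)))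
  obtain ⟨h1, h2⟩ := singular_values_diagonal_mul (t := t)
    (B := Q * Matrix.diagonal (fun i => (r i : ℂ))) ht ht0 hσ hσ0 hU hV
    (by rw [← Matrix.mul_assoc, h])
  -- The adjoint has the same singular values with `r` on the left, so `σ` also vanishes where `r`
  -- does.
  have h' := congrArg Matrix.conjTranspose h
  simp only [Matrix.conjTranspose_mul, Matrix.conjTranspose_conjTranspose,
    Matrix.diagonal_conjTranspose] at h'
  have hs : ∀ f : Fin n → ℝ, star (fun i => (f i : ℂ)) = fun i => (f i : ℂ) := by
    intro f; funext i; simp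
  rw [hs, hs, hs, ← Matrix.mul_assoc V] at h'
  obtain ⟨h3, -⟩ := singular_values_diagonal_mul (t := r) hr hr0 hσ hσ0 hV hU h'
  have hd : ∀ j, t j * (σ j / (t j * r j)) * r j = σ j := by
    intro j
    by_cases hj : t j * r j = 0
    · rcases mul_eq_zero.1 hj with h0 | h0
      · simp [h0, h1 j h0]
      · simp [h0, h3 j h0]
    · rw [mul_right_comm, mul_div_cancel₀ _ hj]
  refine ⟨U, V, fun j => σ j / (t j * r j), hU, hV, fun j hj => by simp [hj], ?_, ?_⟩
  · simp_rw [hd]; exact h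
  · refine le_trans (le_of_eq ?_) h2
    refine Finset.sum_congr rfl fun j _ => ?_
    by_cases hj : r j = 0
    · simp [hj, h3 j hj]
    · rw [← div_pow]
      congr 1
      field_simp

end SingularValues

/-! ### The log-determinant of a fixed channel -/

section LogDet

variable {ι κ : Type*} [Fintype ι] [Fintype κ] [DecidableEq ι]

/-- One diagonalization of `M * Mᴴ` serves every `c`; this reduces the bounds on the determinant to
scalar inequalities in the eigenvalues. -/
lemma exists_det_one_add_smul (M : Matrix ι κ ℂ) :
    ∃ l : ι → ℝ, (∀ i, 0 ≤ l i) ∧ ∑ i, l i = frobSq M ∧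
      ∀ c : ℝ, (1 + (c : ℂ) • (M * Mᴴ)).det.re = ∏ i, (1 + c * l i) := by
  have hp := Matrix.posSemidef_self_mul_conjTranspose M
  have hH := hp.isHermitian
  refine ⟨hH.eigenvalues, hp.eigenvalues_nonneg, ?_, fun c => ?_⟩
  · have := hH.trace_eq_sum_eigenvalues
    rw [← frobSq_eq_trace] at this
    simp only [Complex.coe_algebraMap] at this
    exact_mod_cast this.symm
  · have hs := hH.spectral_theorem
    rw [Unitary.conjStarAlgAut_apply] at hs
    set W : Matrix ι ι ℂ := (hH.eigenvectorUnitary : Matrix ι ι ℂ)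
    have hW : W * star W = 1 := Matrix.mem_unitaryGroup_iff.1 hH.eigenvectorUnitary.2
    have h1 : 1 + (c : ℂ) • (M * Mᴴ) =
        W * Matrix.diagonal (fun i => ((1 + c * hH.eigenvalues i : ℝ) : ℂ)) * star W := by
      have h2 : Matrix.diagonal (fun i => ((1 + c * hH.eigenvalues i : ℝ) : ℂ)) =
          1 + (c : ℂ) • Matrix.diagonal (RCLike.ofReal ∘ hH.eigenvalues : ι → ℂ) := by
        ext i j
        by_cases hij : i = j
        · subst hij; simp
        · simp [hij]
      rw [h2, Matrix.mul_add, Matrix.add_mul, Matrix.mul_one, hW, Matrix.mul_smul,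
        Matrix.smul_mul]
      congr 2
    rw [h1, Matrix.det_mul, Matrix.det_mul, mul_right_comm, ← Matrix.det_mul, hW, Matrix.det_one,
      one_mul, Matrix.det_diagonal, ← Complex.ofReal_prod, Complex.ofReal_re]

/-- The mutual information `log₂ det (I + η M Mᴴ)` of a deterministic channel `M`. -/
def logDet (η : ℝ) (M : Matrix ι κ ℂ) : ℝ :=
  Real.logb 2 (1 + (η : ℂ) • (M * Mᴴ)).det.re

lemma one_le_det {η : ℝ} (hη : 0 ≤ η) (M : Matrix ι κ ℂ) :
    1 ≤ (1 + (η : ℂ) • (M * Mᴴ)).det.re := by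
  obtain ⟨l, hl, -, h⟩ := exists_det_one_add_smul M
  rw [h]
  have := Finset.prod_le_prod (s := Finset.univ) (f := fun _ : ι => (1 : ℝ))
    (g := fun i => 1 + η * l i) (fun _ _ => zero_le_one)
    fun i _ => by linarith [mul_nonneg hη (hl i)]
  simpa using this

lemma logDet_nonneg {η : ℝ} (hη : 0 ≤ η) (M : Matrix ι κ ℂ) : 0 ≤ logDet η M :=
  Real.logb_nonneg one_lt_two (one_le_det hη M)

/-- This is `log (1 + x) ≤ x` summed over eigenvalues. It provides the integrable majorant of the
mutual information. -/
lemma logDet_le {η : ℝ} (hη : 0 ≤ η) (M : Matrix ι κ ℂ) :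
    logDet η M ≤ η / Real.log 2 * frobSq M := by
  have h1 := one_le_det hη M
  obtain ⟨l, hl, hs, h⟩ := exists_det_one_add_smul M
  unfold logDet
  rw [Real.logb, div_mul_eq_mul_div]
  gcongr
  · rw [Real.log_le_iff_le_exp (by linarith), h, ← hs, Finset.mul_sum, Real.exp_sum]
    exact Finset.prod_le_prod (fun i _ => by nlinarith [mul_nonneg hη (hl i)])
      fun i _ => by rw [add_comm]; exact Real.add_one_le_exp _

lemma logDet_le_logDet_smul {η s : ℝ} (hη : 0 ≤ η) (hs : 1 ≤ s) (M : Matrix ι κ ℂ) :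
    logDet η M ≤ logDet η ((s : ℂ) • M) := by
  have h1 := one_le_det hη M
  obtain ⟨l, hl, -, h⟩ := exists_det_one_add_smul M
  have h2 : (η : ℂ) • ((s : ℂ) • M * ((s : ℂ) • M)ᴴ) = ((η * s ^ 2 : ℝ) : ℂ) • (M * Mᴴ) := by
    rw [Matrix.conjTranspose_smul, Matrix.smul_mul, Matrix.mul_smul, smul_smul, smul_smul]
    congr 1
    simp
    ring
  unfold logDet
  rw [h2]
  refine Real.logb_le_logb_of_le one_lt_two (by linarith) ?_
  rw [h, h]
  refine Finset.prod_le_prod (fun i _ => by nlinarith [mul_nonneg hη (hl i)]) fun i _ => ?_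
  have : 1 ≤ s ^ 2 := one_le_pow₀ hs
  nlinarith [mul_nonneg (mul_nonneg hη (hl i)) (sub_nonneg.2 this)]

lemma logDet_mul_unitary [DecidableEq κ] (η : ℝ) (M : Matrix ι κ ℂ) {W : Matrix κ κ ℂ}
    (hW : W ∈ Matrix.unitaryGroup κ ℂ) : logDet η (M * W) = logDet η M := by
  have : M * W * (M * W)ᴴ = M * Mᴴ := by
    rw [Matrix.conjTranspose_mul, Matrix.mul_assoc, ← Matrix.mul_assoc W,
      ← Matrix.star_eq_conjTranspose W, Matrix.mem_unitaryGroup_iff.1 hW, Matrix.one_mul]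
  rw [logDet, this, logDet]

lemma continuous_logDet {η : ℝ} (hη : 0 ≤ η) : Continuous (logDet η : Matrix ι κ ℂ → ℝ) := by
  unfold logDet Real.logb
  refine Continuous.div_const (Continuous.log ?_ fun M => ?_) _
  · exact Complex.continuous_re.comp (Continuous.matrix_det (by fun_prop))
  · linarith [one_le_det hη M]

end LogDet

/-! ### White and deterministic factors of the chain -/

namespace RelayChain

variable {N : ℕ} (S : RelayChain N)

/-- Square root of the receive correlation at level `j`; the identity at the source. -/
def rcv (j : Fin (N + 1)) : Matrix (Fin (S.k j)) (Fin (S.k j)) ℂ :=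
  if j = 0 then 1 else CFC.sqrt (S.Cr j)

lemma rcv_zero : S.rcv 0 = 1 := if_pos rfl

lemma rcv_succ (i : Fin N) : S.rcv i.succ = CFC.sqrt (S.Cr i.succ) := if_neg (Fin.succ_ne_zero i)

/-- The precoder of level `i` together with the correlation roots on both of its sides. -/
def mid (P : S.Precoder) (i : Fin N) : Matrix (Fin (S.k i.castSucc)) (Fin (S.k i.castSucc)) ℂ :=
  CFC.sqrt (S.Ct i) * P i * S.rcv i.castSucc

/-- The product `Θ_j A_{j-1} ⋯ Θ_1 A_0`. -/
def core (A : S.Precoder) (θ : S.Sample) (j : Fin (N + 1)) : Matrix (Fin (S.k j)) (Fin (S.k 0)) ℂ :=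
  Fin.induction (motive := fun j => Matrix (Fin (S.k j)) (Fin (S.k 0)) ℂ) 1
    (fun i G => Matrix.of (θ i) * A i * G) j

lemma core_zero (A : S.Precoder) (θ : S.Sample) : S.core A θ 0 = 1 := rfl

lemma core_succ (A : S.Precoder) (θ : S.Sample) (i : Fin N) :
    S.core A θ i.succ = Matrix.of (θ i) * A i * S.core A θ i.castSucc :=
  Fin.induction_succ ..

lemma chain_succ (P : S.Precoder) (θ : S.Sample) (i : Fin N) :
    S.chain P θ i.succ = S.channel θ i * P i * S.chain P θ i.castSucc :=
  Fin.induction_succ ..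

lemma chain_eq (P : S.Precoder) (θ : S.Sample) (j : Fin (N + 1)) :
    S.chain P θ j = S.rcv j * S.core (S.mid P) θ j := by
  induction j using Fin.induction with
  | zero => rw [rcv_zero, Matrix.one_mul]; rfl
  | succ i ih =>
    rw [chain_succ, core_succ, ih, rcv_succ, mid, channel]
    simp only [Matrix.mul_assoc]

/-- Causality: the signal arriving at level `j` involves only the earlier hops, so it is independent
of the next white matrix. -/
lemma core_congr (A : S.Precoder) {θ θ' : S.Sample} (j : Fin (N + 1))
    (h : ∀ l : Fin N, l.castSucc < j → θ l = θ' l) : S.core A θ j = S.core A θ' j := by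
  induction j using Fin.induction with
  | zero => rfl
  | succ i ih =>
    rw [core_succ, core_succ, ih fun l hl => h l (hl.trans i.castSucc_lt_succ),
      h i i.castSucc_lt_succ]

lemma continuous_core {X : Type*} [TopologicalSpace X] {A : X → S.Precoder} {θ : X → S.Sample}
    (hA : Continuous A) (hθ : Continuous θ) (j : Fin (N + 1)) :
    Continuous fun x => S.core (A x) (θ x) j := by
  induction j using Fin.induction with
  | zero => exact continuous_const
  | succ i ih =>
    simp only [core_succ]
    have h1 : Continuous fun x => Matrix.of (θ x i) := (continuous_apply i).comp hθ
    have h2 : Continuous fun x => A x i := (continuous_apply i).comp hA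
    exact (h1.matrix_mul h2).matrix_mul ih

lemma continuous_mid : Continuous S.mid := by
  refine continuous_pi fun i => ?_
  unfold mid
  have : Continuous fun P : S.Precoder => P i := continuous_apply i
  exact (continuous_const.matrix_mul this).matrix_mul continuous_const

lemma filter_castSucc_lt_succ (i : Fin N) :
    (Finset.univ.filter fun l : Fin N => l.castSucc < i.succ) =
      insert i (Finset.univ.filter fun l : Fin N => l.castSucc < i.castSucc) := by
  ext l
  simp only [Finset.mem_filter, Finset.mem_univ, true_and, Finset.mem_insert]
  rw [Fin.castSucc_lt_succ_iff, Fin.castSucc_lt_castSucc_iff, le_iff_eq_or_lt]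

lemma prod_filter_succ {α : Type*} [CommMonoid α] (f : Fin N → α) (i : Fin N) :
    ∏ l with l.castSucc < i.succ, f l = f i * ∏ l with l.castSucc < i.castSucc, f l := by
  rw [filter_castSucc_lt_succ, Finset.prod_insert (by simp)]

/-- The amplification `E [G Gᴴ] = gain • I` of the matrix `core A`. -/
def gain (A : S.Precoder) (j : Fin (N + 1)) : ℝ :=
  ∏ l : Fin N with l.castSucc < j, frobSq (A l) / S.k l.succ

lemma gain_zero (A : S.Precoder) : S.gain A 0 = 1 := by simp [gain]

lemma gain_succ (A : S.Precoder) (i : Fin N) :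
    S.gain A i.succ = frobSq (A i) / S.k i.succ * S.gain A i.castSucc :=
  prod_filter_succ _ i

lemma gain_nonneg (A : S.Precoder) (j : Fin (N + 1)) : 0 ≤ S.gain A j :=
  Finset.prod_nonneg fun _ _ => div_nonneg (frobSq_nonneg _) (Nat.cast_nonneg _)

lemma frobSq_core_le (A : S.Precoder) (θ : S.Sample) (j : Fin (N + 1)) :
    frobSq (S.core A θ j) ≤
      S.k 0 * ∏ l : Fin N with l.castSucc < j, (frobSq (Matrix.of (θ l)) * frobSq (A l)) := by
  induction j using Fin.induction with
  | zero =>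
    rw [core_zero, ← Matrix.diagonal_one, frobSq_diagonal]
    simp
  | succ i ih =>
    rw [core_succ, prod_filter_succ]
    calc _ ≤ frobSq (Matrix.of (θ i) * A i) * frobSq (S.core A θ i.castSucc) := frobSq_mul_le _ _
      _ ≤ (frobSq (Matrix.of (θ i)) * frobSq (A i)) * _ :=
        mul_le_mul (frobSq_mul_le _ _) ih (frobSq_nonneg _)
          (mul_nonneg (frobSq_nonneg _) (frobSq_nonneg _))
      _ = _ := by ring

/-- Rotation of all the white matrices. -/
def rotate (U : S.Precoder) (V : ∀ j, Matrix (Fin (S.k j)) (Fin (S.k j)) ℂ) (θ : S.Sample) :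
    S.Sample :=
  fun i a b => ((V i.succ)ᴴ * Matrix.of (θ i) * U i) a b

lemma core_rotate {A D U : S.Precoder} {V : ∀ j, Matrix (Fin (S.k j)) (Fin (S.k j)) ℂ}
    (hV : ∀ j, V j ∈ Matrix.unitaryGroup (Fin (S.k j)) ℂ)
    (hA : ∀ i, A i = U i * D i * (V i.castSucc)ᴴ) (θ : S.Sample) (j : Fin (N + 1)) :
    S.core A θ j = V j * S.core D (S.rotate U V θ) j * (V 0)ᴴ := by
  have hVV : ∀ j, V j * (V j)ᴴ = 1 := fun j => Matrix.mem_unitaryGroup_iff.1 (hV j)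
  have hVV' : ∀ j, (V j)ᴴ * V j = 1 := fun j => Matrix.mem_unitaryGroup_iff'.1 (hV j)
  induction j using Fin.induction with
  | zero => rw [core_zero, core_zero, Matrix.mul_one, hVV]
  | succ i ih =>
    have hr : Matrix.of (S.rotate U V θ i) = (V i.succ)ᴴ * Matrix.of (θ i) * U i := rfl
    -- The unitaries telescope: `V` on the left of the previous product meets `Vᴴ` from the
    -- factorization of `A i`.
    rw [core_succ, core_succ, ih, hA, hr]
    simp only [← Matrix.mul_assoc]
    rw [hVV, Matrix.one_mul, Matrix.mul_assoc _ (V i.castSucc)ᴴ, hVV', Matrix.mul_one]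

lemma measurePreserving_rotate {U : S.Precoder} {V : ∀ j, Matrix (Fin (S.k j)) (Fin (S.k j)) ℂ}
    (hU : ∀ i, U i ∈ Matrix.unitaryGroup (Fin (S.k i.castSucc)) ℂ)
    (hV : ∀ j, V j ∈ Matrix.unitaryGroup (Fin (S.k j)) ℂ) :
    MeasurePreserving (S.rotate U V) S.channelLaw S.channelLaw :=
  measurePreserving_pi _ _ fun i =>
    measurePreserving_unitary_mul_mul _ (Unitary.star_mem (hV i.succ)) (hU i)

lemma instMI_eq (η : ℝ) (P : S.Precoder) (θ : S.Sample) :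
    S.instMI η P θ =
      1 / (S.k 0 : ℝ) * logDet η (S.rcv (Fin.last N) * S.core (S.mid P) θ (Fin.last N)) := by
  unfold instMI logDet
  rw [chain_eq]

lemma continuous_instMI {η : ℝ} (hη : 0 ≤ η) {X : Type*} [TopologicalSpace X]
    {P : X → S.Precoder} {θ : X → S.Sample} (hP : Continuous P) (hθ : Continuous θ) :
    Continuous fun x => S.instMI η (P x) (θ x) := by
  simp only [instMI_eq]
  refine continuous_const.mul ((continuous_logDet hη).comp (continuous_const.matrix_mul ?_))
  exact S.continuous_core (S.continuous_mid.comp hP) hθ (Fin.last N)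

lemma instMI_nonneg {η : ℝ} (hη : 0 ≤ η) (P : S.Precoder) (θ : S.Sample) : 0 ≤ S.instMI η P θ := by
  rw [instMI_eq]
  exact mul_nonneg (by positivity) (logDet_nonneg hη _)

lemma instMI_le {η : ℝ} (hη : 0 ≤ η) (P : S.Precoder) (θ : S.Sample) :
    S.instMI η P θ ≤ η / Real.log 2 * frobSq (S.rcv (Fin.last N)) *
      ((∏ l, frobSq (S.mid P l)) * ∏ l, frobSq (Matrix.of (θ l))) := by
  rw [instMI_eq]
  have hk : (0 : ℝ) < S.k 0 := Nat.cast_pos.2 (S.k_pos 0)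
  have hl : 0 ≤ η / Real.log 2 := div_nonneg hη (Real.log_nonneg one_le_two)
  have h1 := logDet_le hη (S.rcv (Fin.last N) * S.core (S.mid P) θ (Fin.last N))
  have h2 := frobSq_mul_le (S.rcv (Fin.last N)) (S.core (S.mid P) θ (Fin.last N))
  have h3 := S.frobSq_core_le (S.mid P) θ (Fin.last N)
  have h4 : (Finset.univ.filter fun l : Fin N => l.castSucc < Fin.last N) = Finset.univ := by
    ext l; simp [Fin.castSucc_lt_last]
  rw [h4, Finset.prod_mul_distrib] at h3
  rw [one_div, inv_mul_le_iff₀ hk]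
  calc _ ≤ _ := h1
    _ ≤ η / Real.log 2 * (frobSq (S.rcv (Fin.last N)) * _) :=
      mul_le_mul_of_nonneg_left
        (h2.trans (mul_le_mul_of_nonneg_left h3 (frobSq_nonneg _))) hl
    _ = _ := by ring

/-- The law of the mutual information depends only on the singular values of `mid P`. -/
lemma map_instMI_eq {η : ℝ} (hη : 0 ≤ η) {P D U V : S.Precoder}
    (hU : ∀ i, U i ∈ Matrix.unitaryGroup (Fin (S.k i.castSucc)) ℂ)
    (hV : ∀ i, V i ∈ Matrix.unitaryGroup (Fin (S.k i.castSucc)) ℂ)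
    (hP : ∀ i, S.mid P i = U i * D i * (V i)ᴴ) :
    S.channelLaw.map (S.instMI η P) = S.channelLaw.map fun θ =>
      1 / (S.k 0 : ℝ) * logDet η (S.rcv (Fin.last N) * S.core D θ (Fin.last N)) := by
  -- The last level gets the identity because the fixed receive root there multiplies from the left
  -- and must not be rotated.
  let W : ∀ j, Matrix (Fin (S.k j)) (Fin (S.k j)) ℂ :=
    Fin.lastCases (motive := fun j => Matrix (Fin (S.k j)) (Fin (S.k j)) ℂ) 1 V
  have hWc : ∀ i : Fin N, W i.castSucc = V i := fun i => Fin.lastCases_castSucc ..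
  have hWl : W (Fin.last N) = 1 := Fin.lastCases_last ..
  have hW : ∀ j, W j ∈ Matrix.unitaryGroup (Fin (S.k j)) ℂ := by
    intro j
    induction j using Fin.lastCases with
    | last => rw [hWl]; exact one_mem _
    | cast i => rw [hWc]; exact hV i
  have hmp := S.measurePreserving_rotate hU hW
  have hf : Continuous fun θ =>
      1 / (S.k 0 : ℝ) * logDet η (S.rcv (Fin.last N) * S.core D θ (Fin.last N)) := by
    refine continuous_const.mul ((continuous_logDet hη).comp (continuous_const.matrix_mul ?_))
    exact S.continuous_core continuous_const continuous_id (Fin.last N)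
  have h0 : S.instMI η P = (fun θ =>
      1 / (S.k 0 : ℝ) * logDet η (S.rcv (Fin.last N) * S.core D θ (Fin.last N))) ∘
        S.rotate U W := by
    funext θ
    have h1 := logDet_mul_unitary η
      (S.rcv (Fin.last N) * S.core D (S.rotate U W θ) (Fin.last N)) (Unitary.star_mem (hW 0))
    have h2 := S.core_rotate (A := S.mid P) hW (D := D) (U := U) (fun i => by rw [hP, hWc]) θ
      (Fin.last N)
    rw [hWl, Matrix.one_mul] at h2
    rw [Matrix.star_eq_conjTranspose, Matrix.mul_assoc, ← h2] at h1
    rw [instMI_eq, h1, Function.comp_apply]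
  rw [h0, ← Measure.map_map hf.measurable hmp.measurable, hmp.map_eq]

end RelayChain

/-! ### Second moments of Gaussian vectors and matrices -/

section Moments

/-- Resampling one coordinate by a fresh independent copy does not change a product law. In this
form independence enters the moment computations. -/
lemma measurePreserving_update {ι : Type*} [Fintype ι] [DecidableEq ι] {X : ι → Type*}
    [∀ i, MeasurableSpace (X i)] (μ : ∀ i, Measure (X i)) [∀ i, IsProbabilityMeasure (μ i)]
    (i : ι) :
    MeasurePreserving (fun p : (∀ i, X i) × X i => Function.update p.1 i p.2)
      ((Measure.pi μ).prod (μ i)) (Measure.pi μ) := by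
  have hm : Measurable (fun p : (∀ i, X i) × X i => Function.update p.1 i p.2) :=
    measurable_update'.comp measurable_id
  refine ⟨hm, (Measure.pi_eq fun s hs => ?_).symm⟩
  rw [Measure.map_apply hm (MeasurableSet.univ_pi hs)]
  have : (fun p : (∀ i, X i) × X i => Function.update p.1 i p.2) ⁻¹' Set.univ.pi s =
      (Set.univ.pi (Function.update s i Set.univ)) ×ˢ s i := by
    ext ⟨θ, t⟩
    simp only [Set.mem_preimage, Set.mem_pi, Set.mem_univ, true_implies, Set.mem_prod]
    constructor
    · intro h
      refine ⟨fun j => ?_, by simpa using h i⟩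
      by_cases hj : j = i
      · subst hj; simp
      · simpa [hj] using h j
    · rintro ⟨h, ht⟩ j
      by_cases hj : j = i
      · subst hj; simpa using ht
      · simpa [hj] using h j
  rw [this, Measure.prod_prod, Measure.pi_pi,
    ← Finset.mul_prod_erase Finset.univ (fun j => μ j (s j)) (Finset.mem_univ i),
    ← Finset.mul_prod_erase Finset.univ _ (Finset.mem_univ i), mul_comm]
  simp only [Function.update_self, measure_univ, one_mul]
  congr 1
  refine Finset.prod_congr rfl fun j hj => ?_
  rw [Function.update_of_ne (Finset.ne_of_mem_erase hj)]

lemma memLp_complexGaussian (v : ℝ≥0) : MemLp id 2 (complexGaussian v) := by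
  have h0 : MemLp (fun x : ℝ => x) 2 (gaussianReal 0 (v / 2)) := memLp_id_gaussianReal 2
  rw [complexGaussian_map, memLp_map_measure_iff (by fun_prop) (by fun_prop)]
  have h1 : MemLp (fun p : ℝ × ℝ => (p.1 : ℂ)) 2
      ((gaussianReal 0 (v / 2)).prod (gaussianReal 0 (v / 2))) :=
    (h0.comp_measurePreserving measurePreserving_fst).ofReal
  have h2 : MemLp (fun p : ℝ × ℝ => (p.2 : ℂ)) 2
      ((gaussianReal 0 (v / 2)).prod (gaussianReal 0 (v / 2))) :=
    (h0.comp_measurePreserving measurePreserving_snd).ofReal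
  exact h1.add (h2.mul_const Complex.I)

lemma integral_complexGaussian (v : ℝ≥0) : ∫ z, z ∂complexGaussian v = 0 := by
  have h0 : Integrable (fun x : ℝ => x) (gaussianReal 0 (v / 2)) :=
    (memLp_id_gaussianReal 1).integrable le_rfl
  have h0' : Integrable (fun x : ℝ => (x : ℂ)) (gaussianReal 0 (v / 2)) := h0.ofReal
  have hz : ∫ x : ℝ, (x : ℂ) ∂(gaussianReal 0 (v / 2)) = 0 := by
    rw [integral_complex_ofReal, integral_id_gaussianReal]; simp
  rw [complexGaussian_map, integral_map (by fun_prop) (by fun_prop),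
    integral_add (h0'.comp_fst _) ((h0'.mul_const Complex.I).comp_snd _),
    integral_fun_fst (fun x : ℝ => (x : ℂ)), integral_fun_snd (fun x : ℝ => (x : ℂ) * Complex.I),
    integral_mul_const, hz]
  simp

lemma integral_sq_norm_complexGaussian (v : ℝ≥0) : ∫ z, ‖z‖ ^ 2 ∂complexGaussian v = v := by
  have h0 : Integrable (fun x : ℝ => x ^ 2) (gaussianReal 0 (v / 2)) :=
    (memLp_id_gaussianReal 2).integrable_sq
  have hz : ∫ x : ℝ, x ^ 2 ∂(gaussianReal 0 (v / 2)) = v / 2 := by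
    have := variance_id_gaussianReal (μ := 0) (v := v / 2)
    rw [variance_of_integral_eq_zero (by fun_prop) (by simp)] at this
    simpa using this
  rw [complexGaussian_map, integral_map (by fun_prop) (by fun_prop)]
  have h : ∀ p : ℝ × ℝ, ‖(p.1 : ℂ) + p.2 * Complex.I‖ ^ 2 = p.1 ^ 2 + p.2 ^ 2 := by
    intro p
    rw [← Complex.normSq_eq_norm_sq, Complex.normSq_add_mul_I]
  simp_rw [h]
  rw [integral_add (h0.comp_fst _) (h0.comp_snd _), integral_fun_fst (fun x : ℝ => x ^ 2),
    integral_fun_snd (fun x : ℝ => x ^ 2), hz]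
  simp

variable {ι : Type*} [Fintype ι]

lemma memLp_eval_complexGaussian (v : ℝ≥0) (a : ι) :
    MemLp (fun x : ι → ℂ => x a) 2 (Measure.pi fun _ : ι => complexGaussian v) :=
  (memLp_complexGaussian v).comp_measurePreserving (measurePreserving_eval _ a)

lemma integral_eval_mul_star (v : ℝ≥0) [DecidableEq ι] (a b : ι) :
    ∫ x : ι → ℂ, x a * star (x b) ∂(Measure.pi fun _ : ι => complexGaussian v) =
      if a = b then (v : ℂ) else 0 := by
  split_ifs with hab
  · subst hab
    have h1 := (measurePreserving_eval (fun _ : ι => complexGaussian v) a).map_eq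
    have h2 : ∀ x : ι → ℂ, x a * star (x a) = ((‖x a‖ ^ 2 : ℝ) : ℂ) := fun x => by
      simp [Complex.mul_conj, Complex.normSq_eq_norm_sq]
    simp_rw [h2]
    have h3 := integral_map (μ := Measure.pi fun _ : ι => complexGaussian v) (φ := Function.eval a)
      (measurable_pi_apply a).aemeasurable (f := fun z : ℂ => ‖z‖ ^ 2) (by fun_prop)
    rw [h1, integral_sq_norm_complexGaussian] at h3
    rw [integral_complex_ofReal, h3]
  · have hu := measurePreserving_update (fun _ : ι => complexGaussian v) a
    rw [← hu.map_eq, integral_map hu.measurable.aemeasurable (by fun_prop)]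
    simp only [Function.update_self, Function.update_of_ne (Ne.symm hab)]
    simp_rw [mul_comm _ (star _)]
    rw [integral_prod_mul (fun x : ι → ℂ => star (x b)) (fun z : ℂ => z),
      integral_complexGaussian, mul_zero]

lemma integrable_sq_norm_sum (v : ℝ≥0) (c : ι → ℂ) :
    Integrable (fun x : ι → ℂ => ‖∑ a, c a * x a‖ ^ 2)
      (Measure.pi fun _ : ι => complexGaussian v) :=
  (memLp_finsetSum _ fun a _ =>
    (memLp_eval_complexGaussian v a).const_mul (c a)).integrable_norm_pow two_ne_zero

lemma integral_sq_norm_sum (v : ℝ≥0) (c : ι → ℂ) :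
    ∫ x : ι → ℂ, ‖∑ a, c a * x a‖ ^ 2 ∂(Measure.pi fun _ : ι => complexGaussian v) =
      v * ∑ a, ‖c a‖ ^ 2 := by
  classical
  have hi : ∀ a b, Integrable (fun x : ι → ℂ => c a * star (c b) * (x a * star (x b)))
      (Measure.pi fun _ : ι => complexGaussian v) := fun a b =>
    ((memLp_eval_complexGaussian v a).integrable_mul
      (memLp_eval_complexGaussian v b).star).const_mul _
  have h : ∀ x : ι → ℂ, ((‖∑ a, c a * x a‖ ^ 2 : ℝ) : ℂ) =
      ∑ a, ∑ b, c a * star (c b) * (x a * star (x b)) := by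
    intro x
    rw [← Complex.normSq_eq_norm_sq, ← Complex.mul_conj, map_sum, Finset.sum_mul_sum]
    refine Finset.sum_congr rfl fun a _ => Finset.sum_congr rfl fun b _ => ?_
    simp
    ring
  apply Complex.ofReal_injective
  rw [← integral_complex_ofReal]
  simp_rw [h]
  rw [integral_finsetSum _ fun a _ => integrable_finsetSum _ fun b _ => hi a b]
  simp_rw [integral_finsetSum Finset.univ fun b _ => hi _ b, integral_const_mul,
    integral_eval_mul_star]
  simp only [mul_ite, mul_zero, Finset.sum_ite_eq, Finset.mem_univ, if_true]
  push_cast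
  rw [Finset.mul_sum]
  refine Finset.sum_congr rfl fun a _ => ?_
  rw [← Complex.ofReal_pow, ← Complex.normSq_eq_norm_sq, ← Complex.mul_conj]
  simp
  ring

lemma mul_mul_apply_eq_sum {κ τ : Type*} {m n : ℕ} (M : Matrix κ (Fin m) ℂ) (t : Fin m × Fin n → ℂ)
    (B : Matrix (Fin n) τ ℂ) (x : κ) (y : τ) :
    (M * Matrix.of (Function.curry t) * B) x y = ∑ p, M x p.1 * B p.2 y * t p := by
  rw [Fintype.sum_prod_type, Matrix.mul_apply]
  simp_rw [Matrix.mul_apply, Finset.sum_mul]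
  rw [Finset.sum_comm]
  refine Finset.sum_congr rfl fun a _ => Finset.sum_congr rfl fun b _ => ?_
  simp only [Matrix.of_apply, Function.curry_apply]
  ring

variable {κ τ : Type*} [Fintype κ] [Fintype τ]

lemma integrable_frobSq_mul_mul {m n : ℕ} (v : ℝ≥0) (M : Matrix κ (Fin m) ℂ)
    (B : Matrix (Fin n) τ ℂ) :
    Integrable (fun t : Fin m → Fin n → ℂ => frobSq (M * Matrix.of t * B))
      (Measure.pi fun _ => Measure.pi fun _ => complexGaussian v) := by
  have hc := measurePreserving_curry_complexGaussian v m n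
  rw [← hc.map_eq, integrable_map_measure]
  · simp only [Function.comp_def, frobSq, mul_mul_apply_eq_sum]
    exact integrable_finsetSum _ fun x _ => integrable_finsetSum _ fun y _ =>
      integrable_sq_norm_sum v _
  · refine Continuous.aestronglyMeasurable (continuous_frobSq.comp ?_)
    exact (continuous_const.matrix_mul continuous_id).matrix_mul continuous_const
  · exact hc.measurable.aemeasurable

lemma integral_frobSq_mul_mul {m n : ℕ} (v : ℝ≥0) (M : Matrix κ (Fin m) ℂ)
    (B : Matrix (Fin n) τ ℂ) :
    ∫ t : Fin m → Fin n → ℂ, frobSq (M * Matrix.of t * B)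
      ∂(Measure.pi fun _ => Measure.pi fun _ => complexGaussian v) =
        v * (frobSq M * frobSq B) := by
  have hc := measurePreserving_curry_complexGaussian v m n
  rw [← hc.map_eq, integral_map hc.measurable.aemeasurable]
  · simp only [frobSq, mul_mul_apply_eq_sum]
    rw [integral_finsetSum _ fun x _ => integrable_finsetSum _ fun y _ =>
      integrable_sq_norm_sum v _]
    simp_rw [integral_finsetSum Finset.univ fun y _ => integrable_sq_norm_sum v _,
      integral_sq_norm_sum, ← Finset.mul_sum, Fintype.sum_prod_type, norm_mul, mul_pow]
    congr 1
    rw [Finset.sum_comm (f := fun b y => ‖B b y‖ ^ 2)]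
    simp_rw [← Finset.mul_sum, Finset.sum_mul]
    refine Finset.sum_congr rfl fun x _ => ?_
    rw [Finset.sum_comm, Finset.sum_congr rfl]
    intro a _
    rw [← Finset.mul_sum]
  · refine Continuous.aestronglyMeasurable (continuous_frobSq.comp ?_)
    exact (continuous_const.matrix_mul continuous_id).matrix_mul continuous_const

end Moments

/-! ### Transmitted power and integrability -/

namespace RelayChain

variable {N : ℕ} (S : RelayChain N)

lemma integrable_frobSq_hop (i : Fin N) :
    Integrable (fun t : Fin (S.k i.succ) → Fin (S.k i.castSucc) → ℂ => frobSq (Matrix.of t))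
      (Measure.pi fun _ => Measure.pi fun _ => complexGaussian (1 / (S.k i.succ : ℝ≥0))) := by
  have := integrable_frobSq_mul_mul (1 / (S.k i.succ : ℝ≥0))
    (1 : Matrix (Fin (S.k i.succ)) (Fin (S.k i.succ)) ℂ)
    (1 : Matrix (Fin (S.k i.castSucc)) (Fin (S.k i.castSucc)) ℂ)
  simpa using this

lemma integrable_prod_frobSq :
    Integrable (fun θ : S.Sample => ∏ l, frobSq (Matrix.of (θ l))) S.channelLaw :=
  Integrable.fintype_prod_dep fun i => S.integrable_frobSq_hop i

lemma continuous_frobSq_mul_core (A : S.Precoder) (j : Fin (N + 1)) {n : ℕ}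
    (M : Matrix (Fin n) (Fin (S.k j)) ℂ) :
    Continuous fun θ : S.Sample => frobSq (M * S.core A θ j) :=
  continuous_frobSq.comp
    (continuous_const.matrix_mul (S.continuous_core continuous_const continuous_id j))

/-- The last white matrix is resampled and integrated out first, contributing the factor `frobSq M *
frobSq (A i) / k` once the remaining product is averaged. The left factor `M` is arbitrary so that
the induction can continue with `A i` in its place. -/
lemma integral_frobSq_mul_core (A : S.Precoder) (j : Fin (N + 1)) :
    ∀ {n : ℕ} (M : Matrix (Fin n) (Fin (S.k j)) ℂ),
      Integrable (fun θ => frobSq (M * S.core A θ j)) S.channelLaw ∧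
      ∫ θ, frobSq (M * S.core A θ j) ∂S.channelLaw = S.gain A j * frobSq M := by
  induction j using Fin.induction with
  | zero =>
    intro n M
    simp only [core_zero, Matrix.mul_one, gain_zero, one_mul]
    exact ⟨integrable_const _, by simp⟩
  | succ i ih =>
    intro n M
    obtain ⟨ih1, ih2⟩ := ih (A i)
    have hu : MeasurePreserving _ (S.channelLaw.prod _) S.channelLaw :=
      measurePreserving_update (fun i : Fin N => Measure.pi fun _ : Fin (S.k i.succ) =>
        Measure.pi fun _ : Fin (S.k i.castSucc) => complexGaussian (1 / (S.k i.succ : ℝ≥0))) i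
    have hc := S.continuous_frobSq_mul_core A i.succ M
    have heq : ∀ (θ : S.Sample) (t : Fin (S.k i.succ) → Fin (S.k i.castSucc) → ℂ),
        frobSq (M * S.core A (Function.update θ i t) i.succ) =
          frobSq (M * Matrix.of t * (A i * S.core A θ i.castSucc)) := by
      intro θ t
      rw [core_succ, Function.update_self, S.core_congr A (θ' := θ) i.castSucc fun l hl => by
        rw [Function.update_of_ne]
        rintro rfl
        exact lt_irrefl _ hl]
      simp only [Matrix.mul_assoc]
    have hint : Integrable (fun p : S.Sample × (Fin (S.k i.succ) → Fin (S.k i.castSucc) → ℂ) =>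
        frobSq (M * S.core A (Function.update p.1 i p.2) i.succ))
        (S.channelLaw.prod (Measure.pi fun _ => Measure.pi fun _ =>
          complexGaussian (1 / (S.k i.succ : ℝ≥0)))) := by
      refine Integrable.mono' ((ih1.mul_prod (S.integrable_frobSq_hop i)).const_mul (frobSq M))
        ((hc.measurable.comp hu.measurable).aestronglyMeasurable) (ae_of_all _ fun p => ?_)
      rw [heq, Real.norm_of_nonneg (frobSq_nonneg _)]
      calc _ ≤ _ := frobSq_mul_le _ _
        _ ≤ frobSq M * frobSq (Matrix.of p.2) * frobSq (A i * S.core A p.1 i.castSucc) :=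
          mul_le_mul_of_nonneg_right (frobSq_mul_le _ _) (frobSq_nonneg _)
        _ = _ := by ring
    refine ⟨(hu.integrable_comp hc.aestronglyMeasurable).1 hint, ?_⟩
    rw [← hu.map_eq, integral_map hu.measurable.aemeasurable hc.aestronglyMeasurable,
      integral_prod _ hint]
    simp_rw [heq, integral_frobSq_mul_mul]
    rw [integral_const_mul, integral_const_mul, ih2, gain_succ]
    push_cast
    ring

/-- The power sent by level `i`. -/
def power (P : S.Precoder) (i : Fin N) : ℝ :=
  S.gain (S.mid P) i.castSucc * frobSq (P i * S.rcv i.castSucc)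

/-- Given the channels, the white source makes the mean energy of `B y₀` equal to `frobSq B`; the
channel average is then `integral_frobSq_mul_core`. -/
lemma trace_txCovariance (P : S.Precoder) (i : Fin N) :
    (S.txCovariance P i).trace.re = S.power P i := by
  let B : S.Sample → Matrix (Fin (S.k i.castSucc)) (Fin (S.k 0)) ℂ := fun θ =>
    P i * S.rcv i.castSucc * S.core (S.mid P) θ i.castSucc
  obtain ⟨h1, h2⟩ := S.integral_frobSq_mul_core (S.mid P) i.castSucc (P i * S.rcv i.castSucc)
  have hB : Continuous B :=
    continuous_const.matrix_mul (S.continuous_core continuous_const continuous_id i.castSucc)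
  have htx : ∀ ω a, S.transmitted P i ω a = ∑ b, B ω.1 a b * ω.2 b := by
    intro ω a
    rw [transmitted, Matrix.mulVec_mulVec, chain_eq, ← Matrix.mul_assoc]
    rfl
  have hrow : ∀ θ a, ∑ b, ‖B θ a b‖ ^ 2 ≤ frobSq (B θ) := fun θ a =>
    Finset.single_le_sum (f := fun a => ∑ b, ‖B θ a b‖ ^ 2) (fun a _ => by positivity)
      (Finset.mem_univ a)
  have hBc : ∀ a b, Continuous fun θ => B θ a b := fun a b => hB.matrix_elem a b
  have hy : Integrable (fun y : Fin (S.k 0) → ℂ => ∑ b, ‖y b‖ ^ 2)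
      (Measure.pi fun _ => complexGaussian 1) :=
    integrable_finsetSum _ fun b _ =>
      (memLp_eval_complexGaussian 1 b).integrable_norm_pow two_ne_zero
  have hcont : ∀ a, Continuous fun ω : S.Sample × (Fin (S.k 0) → ℂ) =>
      ‖∑ b, B ω.1 a b * ω.2 b‖ ^ 2 := fun a =>
    (continuous_finsetSum _ fun b _ => ((hBc a b).comp continuous_fst).mul
      ((continuous_apply b).comp continuous_snd)).norm.pow 2
  have hint : ∀ a, Integrable (fun ω : S.Sample × (Fin (S.k 0) → ℂ) =>
      ‖∑ b, B ω.1 a b * ω.2 b‖ ^ 2) S.signalLaw := by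
    intro a
    refine Integrable.mono' (h1.mul_prod hy) (hcont a).aestronglyMeasurable
      (ae_of_all _ fun ω => ?_)
    rw [Real.norm_of_nonneg (by positivity)]
    have h3 : ‖∑ b, B ω.1 a b * ω.2 b‖ ^ 2 ≤ (∑ b, ‖B ω.1 a b‖ * ‖ω.2 b‖) ^ 2 := by
      gcongr
      exact (norm_sum_le _ _).trans_eq (by simp)
    exact h3.trans ((Finset.sum_mul_sq_le_sq_mul_sq _ _ _).trans
      (mul_le_mul_of_nonneg_right (hrow _ a) (by positivity)))
  have hdiag : ∀ a, (S.txCovariance P i a a).re = ∫ θ, ∑ b, ‖B θ a b‖ ^ 2 ∂S.channelLaw := by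
    intro a
    have h4 : ∀ ω, S.transmitted P i ω a * star (S.transmitted P i ω a) =
        ((‖∑ b, B ω.1 a b * ω.2 b‖ ^ 2 : ℝ) : ℂ) := by
      intro ω
      rw [htx, RCLike.star_def, Complex.mul_conj, Complex.normSq_eq_norm_sq]
    rw [txCovariance, Matrix.of_apply]
    simp_rw [h4]
    rw [integral_complex_ofReal, Complex.ofReal_re, signalLaw, integral_prod _ (hint a)]
    simp_rw [integral_sq_norm_sum]
    simp
  rw [Matrix.trace, Complex.re_sum]
  simp_rw [Matrix.diag_apply, hdiag]
  rw [← integral_finsetSum]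
  · exact h2
  · intro a _
    refine Integrable.mono' h1 (continuous_finsetSum _ fun b _ =>
      (hBc a b).norm.pow 2).aestronglyMeasurable (ae_of_all _ fun θ => ?_)
    rw [Real.norm_of_nonneg (by positivity)]
    exact hrow θ a

lemma feasible_iff (budget : Fin N → ℝ) (P : S.Precoder) :
    S.Feasible budget P ↔ ∀ i, S.power P i ≤ budget i := by
  simp only [Feasible, trace_txCovariance]

lemma integrable_instMI {η : ℝ} (hη : 0 ≤ η) (P : S.Precoder) :
    Integrable (S.instMI η P) S.channelLaw := by
  refine Integrable.mono' ((S.integrable_prod_frobSq.const_mul (∏ l, frobSq (S.mid P l))).const_mul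
    (η / Real.log 2 * frobSq (S.rcv (Fin.last N)))) ?_ (ae_of_all _ fun θ => ?_)
  · exact (S.continuous_instMI hη continuous_const continuous_id).aestronglyMeasurable
  · rw [Real.norm_of_nonneg (S.instMI_nonneg hη _ _)]
    exact S.instMI_le hη P θ

lemma continuous_averageMI {η : ℝ} (hη : 0 ≤ η) : Continuous (S.averageMI η) := by
  have : FirstCountableTopology S.Precoder := inferInstanceAs (FirstCountableTopology
    (∀ i : Fin N, Fin (S.k i.castSucc) → Fin (S.k i.castSucc) → ℂ))
  rw [continuous_iff_continuousAt]
  intro P₀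
  have hq : Continuous fun P : S.Precoder => ∏ l, frobSq (S.mid P l) :=
    continuous_finsetProd _ fun l _ =>
      continuous_frobSq.comp ((continuous_apply l).comp S.continuous_mid)
  set q := fun P : S.Precoder => ∏ l, frobSq (S.mid P l)
  have hc : 0 ≤ η / Real.log 2 * frobSq (S.rcv (Fin.last N)) :=
    mul_nonneg (div_nonneg hη (Real.log_nonneg one_le_two)) (frobSq_nonneg _)
  refine continuousAt_of_dominated (bound := fun θ =>
    η / Real.log 2 * frobSq (S.rcv (Fin.last N)) *
      ((q P₀ + 1) * ∏ l, frobSq (Matrix.of (θ l)))) ?_ ?_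
    ((S.integrable_prod_frobSq.const_mul _).const_mul _) ?_
  · exact Eventually.of_forall fun P => (S.integrable_instMI hη P).aestronglyMeasurable
  -- Near `P₀` the deterministic part of the bound is at most `q P₀ + 1`, which yields one majorant
  -- for all nearby precoders.
  · have : ∀ᶠ P in 𝓝 P₀, q P < q P₀ + 1 := hq.continuousAt.eventually_lt_const (lt_add_one _)
    filter_upwards [this] with P hP
    refine ae_of_all _ fun θ => ?_
    rw [Real.norm_of_nonneg (S.instMI_nonneg hη _ _)]
    refine (S.instMI_le hη P θ).trans (mul_le_mul_of_nonneg_left ?_ hc)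
    exact mul_le_mul_of_nonneg_right hP.le (Finset.prod_nonneg fun _ _ => frobSq_nonneg _)
  · refine ae_of_all _ fun θ => Continuous.continuousAt ?_
    exact S.continuous_instMI hη continuous_id continuous_const

end RelayChain

/-! ### Aligned precoders and their cost -/

lemma conjTranspose_mem_unitaryGroup {n : ℕ} {U : Matrix (Fin n) (Fin n) ℂ}
    (hU : U ∈ Matrix.unitaryGroup (Fin n) ℂ) : Uᴴ ∈ Matrix.unitaryGroup (Fin n) ℂ :=
  Unitary.star_mem hU

lemma sqrt_eq_of_eigendecomposition {n : ℕ} {C U : Matrix (Fin n) (Fin n) ℂ} {l : Fin n → ℝ}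
    (hC : C.PosSemidef) (hU : U ∈ Matrix.unitaryGroup (Fin n) ℂ)
    (h : C = U * Matrix.diagonal (fun a => (l a : ℂ)) * Uᴴ) :
    CFC.sqrt C = U * Matrix.diagonal (fun a => ((√(l a) : ℝ) : ℂ)) * Uᴴ := by
  have hUU : Uᴴ * U = 1 := Matrix.mem_unitaryGroup_iff'.1 hU
  -- Nonnegativity of the eigenvalues is not part of the decomposition; it comes from `C` being
  -- positive semidefinite.
  have hl : ∀ a, 0 ≤ l a := by
    have h1 := hC.conjTranspose_mul_mul_same U
    have h2 : Uᴴ * C * U = Matrix.diagonal (fun a => (l a : ℂ)) := by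
      rw [h]
      simp only [← Matrix.mul_assoc]
      rw [hUU, Matrix.one_mul, Matrix.mul_assoc, hUU, Matrix.mul_one]
    rw [h2, Matrix.posSemidef_diagonal_iff] at h1
    intro a
    exact Complex.zero_le_real.1 (h1 a)
  refine CFC.sqrt_unique ?_ ?_
  · have : U * Matrix.diagonal (fun a => ((√(l a) : ℝ) : ℂ)) * Uᴴ *
        (U * Matrix.diagonal (fun a => ((√(l a) : ℝ) : ℂ)) * Uᴴ) =
        U * (Matrix.diagonal (fun a => ((√(l a) : ℝ) : ℂ)) *
          Matrix.diagonal (fun a => ((√(l a) : ℝ) : ℂ))) * Uᴴ := by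
      simp only [Matrix.mul_assoc]
      rw [← Matrix.mul_assoc Uᴴ, hUU, Matrix.one_mul]
    rw [this, Matrix.diagonal_mul_diagonal, h]
    congr 3
    funext a
    rw [← Complex.ofReal_mul, Real.mul_self_sqrt (hl a)]
  · rw [Matrix.nonneg_iff_posSemidef]
    refine Matrix.PosSemidef.mul_mul_conjTranspose_same ?_ U
    rw [Matrix.posSemidef_diagonal_iff]
    exact fun a => Complex.zero_le_real.2 (Real.sqrt_nonneg _)

namespace RelayChain

variable {N : ℕ} {S : RelayChain N}

namespace EigenFrame

variable (E : S.EigenFrame)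

/-- Receive eigenvectors at level `j`; the identity at the source. -/
def rcvU (j : Fin (N + 1)) : Matrix (Fin (S.k j)) (Fin (S.k j)) ℂ := if j = 0 then 1 else E.Ur j

/-- Eigenvalues of `C_r^{1/2}` at level `j`; one at the source. -/
def rcvRoot (j : Fin (N + 1)) (a : Fin (S.k j)) : ℝ := if j = 0 then 1 else √(E.lr j a)

/-- Eigenvalues of `C_t^{1/2}`. -/
def txRoot (i : Fin N) (a : Fin (S.k i.castSucc)) : ℝ := √(E.lt i a)

lemma rcvU_unitary (j : Fin (N + 1)) : E.rcvU j ∈ Matrix.unitaryGroup (Fin (S.k j)) ℂ := by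
  cases j using Fin.cases with
  | zero => rw [rcvU, if_pos rfl]; exact one_mem _
  | succ i => rw [rcvU, if_neg (Fin.succ_ne_zero i)]; exact E.Ur_unitary i

lemma rcvRoot_nonneg (j : Fin (N + 1)) (a : Fin (S.k j)) : 0 ≤ E.rcvRoot j a := by
  unfold rcvRoot; split_ifs <;> positivity

lemma txRoot_nonneg (i : Fin N) (a : Fin (S.k i.castSucc)) : 0 ≤ E.txRoot i a :=
  Real.sqrt_nonneg _

lemma rcvRoot_antitone (j : Fin (N + 1)) : Antitone (E.rcvRoot j) := by
  intro a b hab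
  cases j using Fin.cases with
  | zero => simp [rcvRoot]
  | succ i =>
    simp only [rcvRoot, if_neg (Fin.succ_ne_zero i)]
    exact Real.sqrt_le_sqrt (E.lr_antitone i hab)

lemma txRoot_antitone (i : Fin N) : Antitone (E.txRoot i) := fun _ _ hab =>
  Real.sqrt_le_sqrt (E.lt_antitone i hab)

lemma rcv_eq (j : Fin (N + 1)) :
    S.rcv j = E.rcvU j * Matrix.diagonal (fun a => (E.rcvRoot j a : ℂ)) * (E.rcvU j)ᴴ := by
  cases j using Fin.cases with
  | zero => simp [rcvU, rcvRoot, rcv_zero]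
  | succ i =>
    simp only [rcvU, rcvRoot, if_neg (Fin.succ_ne_zero i), rcv_succ]
    exact sqrt_eq_of_eigendecomposition (S.Cr_posSemidef i) (E.Ur_unitary i) (E.Cr_eq i)

lemma sqrt_Ct_eq (i : Fin N) :
    CFC.sqrt (S.Ct i) =
      E.Ut i * Matrix.diagonal (fun a => (E.txRoot i a : ℂ)) * (E.Ut i)ᴴ :=
  sqrt_eq_of_eigendecomposition (S.Ct_posSemidef i) (E.Ut_unitary i) (E.Ct_eq i)

/-- The aligned precoders with the real diagonals `d`. -/
def precoder (d : ∀ i : Fin N, Fin (S.k i.castSucc) → ℝ) : S.Precoder := fun i =>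
  E.Ut i * Matrix.diagonal (fun a => (d i a : ℂ)) * (E.rcvU i.castSucc)ᴴ

variable (d : ∀ i : Fin N, Fin (S.k i.castSucc) → ℝ)

lemma aligned_precoder : Aligned E (E.precoder d) := by
  have h0 : ∀ j : Fin (N + 1), (j : ℕ) = 0 → E.rcvU j = 1 := fun j hj =>
    if_pos (Fin.ext hj)
  have h1 : ∀ j : Fin (N + 1), (j : ℕ) ≠ 0 → E.rcvU j = E.Ur j := fun j hj =>
    if_neg fun h => hj (by rw [h]; rfl)
  refine ⟨fun i a => (d i a : ℂ), fun i => ⟨fun hi => ?_, fun hi => ?_⟩⟩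
  · rw [precoder, h0 _ hi, Matrix.conjTranspose_one, Matrix.mul_one]
  · rw [precoder, h1 _ hi]

lemma precoder_mul_rcv (i : Fin N) :
    E.precoder d i * S.rcv i.castSucc = E.Ut i *
      Matrix.diagonal (fun a => ((d i a * E.rcvRoot i.castSucc a : ℝ) : ℂ)) *
        (E.rcvU i.castSucc)ᴴ := by
  have h : (E.rcvU i.castSucc)ᴴ * E.rcvU i.castSucc = 1 :=
    Matrix.mem_unitaryGroup_iff'.1 (E.rcvU_unitary _)
  rw [precoder, E.rcv_eq]
  simp only [Complex.ofReal_mul, ← Matrix.diagonal_mul_diagonal, Matrix.mul_assoc]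
  rw [← Matrix.mul_assoc (E.rcvU i.castSucc)ᴴ, h, Matrix.one_mul]

lemma mid_precoder (i : Fin N) :
    S.mid (E.precoder d) i = E.Ut i *
      Matrix.diagonal (fun a => ((E.txRoot i a * d i a * E.rcvRoot i.castSucc a : ℝ) : ℂ)) *
        (E.rcvU i.castSucc)ᴴ := by
  have h : (E.Ut i)ᴴ * E.Ut i = 1 := Matrix.mem_unitaryGroup_iff'.1 (E.Ut_unitary _)
  rw [mid, Matrix.mul_assoc, E.precoder_mul_rcv, E.sqrt_Ct_eq]
  simp only [Complex.ofReal_mul, ← Matrix.diagonal_mul_diagonal, Matrix.mul_assoc]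
  rw [← Matrix.mul_assoc (E.Ut i)ᴴ, h, Matrix.one_mul]

lemma frobSq_precoder_mul_rcv (i : Fin N) :
    frobSq (E.precoder d i * S.rcv i.castSucc) = ∑ a, (d i a * E.rcvRoot i.castSucc a) ^ 2 := by
  rw [E.precoder_mul_rcv, frobSq_mul_unitary (conjTranspose_mem_unitaryGroup (E.rcvU_unitary _)),
    frobSq_unitary_mul (E.Ut_unitary i), frobSq_diagonal]
  simp only [Complex.norm_real, Real.norm_eq_abs, sq_abs]

lemma frobSq_mid_precoder (i : Fin N) :
    frobSq (S.mid (E.precoder d) i) =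
      ∑ a, (E.txRoot i a * d i a * E.rcvRoot i.castSucc a) ^ 2 := by
  rw [E.mid_precoder, frobSq_mul_unitary (conjTranspose_mem_unitaryGroup (E.rcvU_unitary _)),
    frobSq_unitary_mul (E.Ut_unitary i), frobSq_diagonal]
  simp only [Complex.norm_real, Real.norm_eq_abs, sq_abs]

/-- Alignment of the singular vectors keeps the law of the mutual information and does not increase
the power at any level. -/
lemma exists_aligned_same_law {η : ℝ} (hη : 0 ≤ η) (P : S.Precoder) :
    ∃ d : ∀ i : Fin N, Fin (S.k i.castSucc) → ℝ,
      (∀ i a, E.txRoot i a * E.rcvRoot i.castSucc a = 0 → d i a = 0) ∧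
      (∀ i, S.power (E.precoder d) i ≤ S.power P i) ∧
      S.channelLaw.map (S.instMI η (E.precoder d)) = S.channelLaw.map (S.instMI η P) := by
  -- Each precoder is written in the eigenbases of its two neighbouring correlation matrices, where
  -- both roots become diagonal and decreasing.
  choose U V d hU hV hd hUV hle using fun i : Fin N =>
    exists_aligned_diagonal (E.txRoot_antitone i) (E.txRoot_nonneg i)
      (E.rcvRoot_antitone i.castSucc) (E.rcvRoot_nonneg i.castSucc)
      ((E.Ut i)ᴴ * P i * E.rcvU i.castSucc)
  let D : S.Precoder := fun i =>
    Matrix.diagonal (fun a => ((E.txRoot i a * d i a * E.rcvRoot i.castSucc a : ℝ) : ℂ))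
  have hmid : ∀ i, S.mid P i = (E.Ut i * U i) * D i * (E.rcvU i.castSucc * V i)ᴴ := by
    intro i
    have : (E.Ut i * U i) * D i * (E.rcvU i.castSucc * V i)ᴴ =
        E.Ut i * (U i * D i * (V i)ᴴ) * (E.rcvU i.castSucc)ᴴ := by
      rw [Matrix.conjTranspose_mul]; simp only [Matrix.mul_assoc]
    rw [this, ← hUV, mid, E.sqrt_Ct_eq, E.rcv_eq]
    simp only [Matrix.mul_assoc]
  have hUU : ∀ i, E.Ut i * U i ∈ Matrix.unitaryGroup (Fin (S.k i.castSucc)) ℂ := fun i =>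
    mul_mem (E.Ut_unitary i) (hU i)
  have hVV : ∀ i, E.rcvU i.castSucc * V i ∈ Matrix.unitaryGroup (Fin (S.k i.castSucc)) ℂ :=
    fun i => mul_mem (E.rcvU_unitary _) (hV i)
  refine ⟨d, hd, fun i => ?_, ?_⟩
  -- Equal singular values of all the `mid`s give equal gains, so the powers are compared through
  -- their last factor alone.
  · have hg : S.gain (S.mid (E.precoder d)) = S.gain (S.mid P) := by
      funext j
      unfold gain
      refine Finset.prod_congr rfl fun l _ => ?_
      rw [hmid, E.mid_precoder]
      rw [frobSq_mul_unitary (conjTranspose_mem_unitaryGroup (E.rcvU_unitary _)),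
        frobSq_unitary_mul (E.Ut_unitary l),
        frobSq_mul_unitary (conjTranspose_mem_unitaryGroup (hVV l)),
        frobSq_unitary_mul (hUU l)]
    rw [power, power, hg, E.frobSq_precoder_mul_rcv]
    refine mul_le_mul_of_nonneg_left ((hle i).trans (le_of_eq ?_)) (S.gain_nonneg _ _)
    rw [E.rcv_eq, ← Matrix.mul_assoc,
      frobSq_mul_unitary (conjTranspose_mem_unitaryGroup (E.rcvU_unitary _)), Matrix.mul_assoc,
      Matrix.mul_assoc, frobSq_unitary_mul (conjTranspose_mem_unitaryGroup (E.Ut_unitary i))]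
  · rw [S.map_instMI_eq hη hUU hVV hmid,
      S.map_instMI_eq hη E.Ut_unitary (fun i => E.rcvU_unitary _) (D := D) (E.mid_precoder d)]

end EigenFrame

end RelayChain

/-! ### Existence of finite-size optimal aligned precoders -/

lemma exists_pos_le_of_ne_zero {ι : Type*} [Finite ι] (f : ι → ℝ) (hf : ∀ i, 0 ≤ f i) :
    ∃ δ : ℝ, 0 < δ ∧ ∀ i, f i ≠ 0 → δ ≤ f i := by
  rcases isEmpty_or_nonempty {i // f i ≠ 0} with he | he
  · exact ⟨1, one_pos, fun i hi => (he.false ⟨i, hi⟩).elim⟩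
  · obtain ⟨x, hx⟩ := Finite.exists_min fun i : {i // f i ≠ 0} => f i
    exact ⟨f x, lt_of_le_of_ne (hf x) (Ne.symm x.2), fun i hi => hx ⟨i, hi⟩⟩

namespace RelayChain

variable {N : ℕ} {S : RelayChain N}

lemma measurable_instMI {η : ℝ} (hη : 0 ≤ η) (P : S.Precoder) : Measurable (S.instMI η P) :=
  (S.continuous_instMI hη continuous_const continuous_id).measurable

lemma averageMI_eq_of_map_eq {η : ℝ} (hη : 0 ≤ η) {P Q : S.Precoder}
    (h : S.channelLaw.map (S.instMI η P) = S.channelLaw.map (S.instMI η Q)) :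
    S.averageMI η P = S.averageMI η Q := by
  have h := congrArg (fun μ : Measure ℝ => ∫ x, x ∂μ) h
  rwa [integral_map (measurable_instMI hη _).aemeasurable (by fun_prop),
    integral_map (measurable_instMI hη _).aemeasurable (by fun_prop)] at h

lemma power_nonneg (P : S.Precoder) (i : Fin N) : 0 ≤ S.power P i :=
  mul_nonneg (S.gain_nonneg _ _) (frobSq_nonneg _)

lemma averageMI_nonneg {η : ℝ} (hη : 0 ≤ η) (P : S.Precoder) : 0 ≤ S.averageMI η P :=
  integral_nonneg fun θ => S.instMI_nonneg hη P θ

/-- A silent level means that either an earlier `mid` vanishes or its own does, and the product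
bound `instMI_le` is then zero. -/
lemma instMI_eq_zero_of_power_eq_zero {η : ℝ} (hη : 0 ≤ η) {P : S.Precoder} {i : Fin N}
    (h : S.power P i = 0) (θ : S.Sample) : S.instMI η P θ = 0 := by
  have h1 : ∃ l, frobSq (S.mid P l) = 0 := by
    rcases mul_eq_zero.1 h with h | h
    · obtain ⟨l, -, hl⟩ := Finset.prod_eq_zero_iff.1 h
      refine ⟨l, ?_⟩
      have hk : (S.k l.succ : ℝ) ≠ 0 := Nat.cast_ne_zero.2 (S.k_pos _).ne'
      simpa [hk] using hl
    · refine ⟨i, ?_⟩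
      rw [frobSq_eq_zero_iff] at h ⊢
      rw [mid, Matrix.mul_assoc, h, Matrix.mul_zero]
  obtain ⟨l, hl⟩ := h1
  have h2 : ∏ l, frobSq (S.mid P l) = 0 := Finset.prod_eq_zero (Finset.mem_univ l) hl
  refine le_antisymm ?_ (S.instMI_nonneg hη P θ)
  have := S.instMI_le hη P θ
  rwa [h2, zero_mul, mul_zero] at this

lemma averageMI_eq_zero_of_power_eq_zero {η : ℝ} (hη : 0 ≤ η) {P : S.Precoder} {i : Fin N}
    (h : S.power P i = 0) : S.averageMI η P = 0 := by
  simp [averageMI, instMI_eq_zero_of_power_eq_zero hη h]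

/-- The precoder obtained by scaling the precoding matrix of level `i` by `s (i+1) / s i`. -/
def rescale (s : Fin (N + 1) → ℝ) (P : S.Precoder) : S.Precoder := fun i =>
  ((s i.succ / s i.castSucc : ℝ) : ℂ) • P i

lemma mid_rescale (s : Fin (N + 1) → ℝ) (P : S.Precoder) (i : Fin N) :
    S.mid (rescale s P) i = ((s i.succ / s i.castSucc : ℝ) : ℂ) • S.mid P i := by
  rw [mid, rescale, Matrix.mul_smul, Matrix.smul_mul, mid]

lemma core_rescale {s : Fin (N + 1) → ℝ} (hs0 : s 0 = 1) (hs : ∀ j, 0 < s j)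
    (P : S.Precoder) (θ : S.Sample) (j : Fin (N + 1)) :
    S.core (S.mid (rescale s P)) θ j = (s j : ℂ) • S.core (S.mid P) θ j := by
  induction j using Fin.induction with
  | zero => rw [core_zero, core_zero, hs0, Complex.ofReal_one, one_smul]
  | succ i ih =>
    rw [core_succ, core_succ, ih, mid_rescale, Matrix.mul_smul, Matrix.mul_smul, Matrix.smul_mul,
      smul_smul, ← Complex.ofReal_mul, mul_comm (s i.castSucc), div_mul_cancel₀ _ (hs _).ne']

lemma gain_rescale {s : Fin (N + 1) → ℝ} (hs0 : s 0 = 1) (hs : ∀ j, 0 < s j)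
    (P : S.Precoder) (j : Fin (N + 1)) :
    S.gain (S.mid (rescale s P)) j = s j ^ 2 * S.gain (S.mid P) j := by
  induction j using Fin.induction with
  | zero => rw [gain_zero, gain_zero, hs0]; norm_num
  | succ i ih =>
    have := (hs i.castSucc).ne'
    rw [gain_succ, gain_succ, ih, mid_rescale, frobSq_smul, Complex.norm_real, Real.norm_eq_abs,
      sq_abs]
    field_simp

/-- The ratios telescope, so each level's power is tuned by its own factor `s i.succ`, independently
of the others. -/
lemma power_rescale {s : Fin (N + 1) → ℝ} (hs0 : s 0 = 1) (hs : ∀ j, 0 < s j)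
    (P : S.Precoder) (i : Fin N) :
    S.power (rescale s P) i = s i.succ ^ 2 * S.power P i := by
  have := (hs i.castSucc).ne'
  rw [power, power, gain_rescale hs0 hs, rescale, Matrix.smul_mul, frobSq_smul, Complex.norm_real,
    Real.norm_eq_abs, sq_abs]
  field_simp

lemma averageMI_le_averageMI_rescale {s : Fin (N + 1) → ℝ} (hs0 : s 0 = 1) (hs : ∀ j, 0 < s j)
    {η : ℝ} (hη : 0 ≤ η) (hl : 1 ≤ s (Fin.last N))
    (P : S.Precoder) : S.averageMI η P ≤ S.averageMI η (rescale s P) := by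
  refine integral_mono (S.integrable_instMI hη _) (S.integrable_instMI hη _) fun θ => ?_
  simp only [instMI_eq]
  rw [core_rescale hs0 hs, Matrix.mul_smul]
  exact mul_le_mul_of_nonneg_left (logDet_le_logDet_smul hη hl _) (by positivity)

namespace EigenFrame

variable (E : S.EigenFrame)

lemma rescale_precoder (s : Fin (N + 1) → ℝ) (d : ∀ i : Fin N, Fin (S.k i.castSucc) → ℝ) :
    rescale s (E.precoder d) =
      E.precoder fun i a => s i.succ / s i.castSucc * d i a := by
  funext i
  have : Matrix.diagonal (fun a => ((s i.succ / s i.castSucc * d i a : ℝ) : ℂ)) =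
      ((s i.succ / s i.castSucc : ℝ) : ℂ) • Matrix.diagonal (fun a => (d i a : ℂ)) := by
    rw [← Matrix.diagonal_smul]
    congr 1
    funext a
    simp
  rw [rescale, precoder, precoder, this, Matrix.mul_smul, Matrix.smul_mul]

/-- The diagonals of aligned precoders that spend exactly the budgets. -/
def fullPower (budget : Fin N → ℝ) : Set (∀ i : Fin N, Fin (S.k i.castSucc) → ℝ) :=
  {d | (∀ i, S.power (E.precoder d) i = budget i) ∧
    ∀ i a, E.txRoot i a * E.rcvRoot i.castSucc a = 0 → d i a = 0}

lemma continuous_precoder : Continuous E.precoder := by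
  refine continuous_pi fun i => ?_
  unfold precoder
  refine (continuous_const.matrix_mul (Continuous.matrix_diagonal ?_)).matrix_mul continuous_const
  fun_prop

lemma continuous_power (i : Fin N) : Continuous fun P : S.Precoder => S.power P i := by
  unfold power gain
  refine (continuous_finsetProd _ fun l _ => ?_).mul (continuous_frobSq.comp ?_)
  · exact (continuous_frobSq.comp ((continuous_apply l).comp S.continuous_mid)).div_const _
  · exact (continuous_apply i).matrix_mul continuous_const

/-- Positive mutual information forces positive power at every level, so after alignment each level
can be amplified up to its budget. The end-to-end matrix is only multiplied by `s (Fin.last N) ≥ 1`.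
-/
lemma exists_fullPower_ge {η : ℝ} (hη : 0 ≤ η) {budget : Fin N → ℝ} {Q : S.Precoder}
    (hQ : S.Feasible budget Q) (hpos : 0 < S.averageMI η Q) :
    ∃ d ∈ E.fullPower budget, S.averageMI η Q ≤ S.averageMI η (E.precoder d) := by
  obtain ⟨d, hd, hle, hlaw⟩ := E.exists_aligned_same_law hη Q
  have havg := averageMI_eq_of_map_eq hη hlaw
  have hpow : ∀ i, 0 < S.power (E.precoder d) i := fun i =>
    lt_of_le_of_ne (power_nonneg _ _) fun h => by
      rw [← havg, averageMI_eq_zero_of_power_eq_zero hη h.symm] at hpos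
      exact lt_irrefl _ hpos
  have hfull : ∀ i, S.power (E.precoder d) i ≤ budget i := fun i =>
    (hle i).trans ((S.feasible_iff budget Q).1 hQ i)
  let s : Fin (N + 1) → ℝ := Fin.cases 1 fun i => √(budget i / S.power (E.precoder d) i)
  have hs0 : s 0 = 1 := rfl
  have hsi : ∀ i, s i.succ = √(budget i / S.power (E.precoder d) i) := fun i => rfl
  have hs1 : ∀ j, 1 ≤ s j := by
    intro j
    induction j using Fin.cases with
    | zero => exact le_rfl
    | succ i => rw [hsi, Real.one_le_sqrt, one_le_div (hpow i)]; exact hfull i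
  have hs : ∀ j, 0 < s j := fun j => one_pos.trans_le (hs1 j)
  refine ⟨fun i a => s i.succ / s i.castSucc * d i a, ⟨fun i => ?_, fun i a h => ?_⟩, ?_⟩
  · rw [← E.rescale_precoder, power_rescale hs0 hs, hsi, Real.sq_sqrt,
      div_mul_cancel₀ _ (hpow i).ne']
    exact div_nonneg ((hpow i).le.trans (hfull i)) (hpow i).le
  · exact (congrArg _ (hd i a h)).trans (mul_zero _)
  · rw [← E.rescale_precoder, ← havg]
    exact averageMI_le_averageMI_rescale hs0 hs hη (hs1 _) _

/-- Spending the whole budget at level `i` keeps the gain at level `i + 1` away from zero, because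
the diagonal vanishes where the transmit root does. With gains bounded below, the power bounds the
diagonal entries. -/
lemma isCompact_fullPower {budget : Fin N → ℝ} (hb : ∀ i, 0 < budget i) :
    IsCompact (E.fullPower budget) := by
  obtain ⟨δ, hδ, hδt⟩ := exists_pos_le_of_ne_zero
    (fun p : Σ i : Fin N, Fin (S.k i.castSucc) => E.txRoot p.1 p.2 ^ 2) fun _ => sq_nonneg _
  obtain ⟨δ', hδ', hδr⟩ := exists_pos_le_of_ne_zero
    (fun p : Σ i : Fin N, Fin (S.k i.castSucc) => E.rcvRoot p.1.castSucc p.2 ^ 2)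
    fun _ => sq_nonneg _
  have hgain : ∀ j, ∃ ε : ℝ, 0 < ε ∧
      ∀ d ∈ E.fullPower budget, ε ≤ S.gain (S.mid (E.precoder d)) j := by
    intro j
    induction j using Fin.cases with
    | zero => exact ⟨1, one_pos, fun d _ => by rw [gain_zero]⟩
    | succ i =>
      have hk : (0 : ℝ) < S.k i.succ := Nat.cast_pos.2 (S.k_pos _)
      refine ⟨δ * budget i / S.k i.succ, by have := hb i; positivity, fun d hd => ?_⟩
      have h1 : δ * frobSq (E.precoder d i * S.rcv i.castSucc) ≤
          frobSq (S.mid (E.precoder d) i) := by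
        rw [E.frobSq_precoder_mul_rcv, E.frobSq_mid_precoder, Finset.mul_sum]
        refine Finset.sum_le_sum fun a _ => ?_
        by_cases ht : E.txRoot i a = 0
        · rw [hd.2 i a (by rw [ht, zero_mul])]; simp
        · rw [mul_assoc, mul_pow (E.txRoot i a)]
          exact mul_le_mul_of_nonneg_right (hδt ⟨i, a⟩ (pow_ne_zero 2 ht)) (sq_nonneg _)
      rw [gain_succ, ← hd.1 i, power, div_mul_eq_mul_div]
      refine div_le_div_of_nonneg_right ?_ hk.le
      calc _ = δ * frobSq (E.precoder d i * S.rcv i.castSucc) * S.gain _ i.castSucc := by ring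
        _ ≤ _ := mul_le_mul_of_nonneg_right h1 (S.gain_nonneg _ _)
  choose ε hε hεg using hgain
  let R : ∀ i : Fin N, Fin (S.k i.castSucc) → ℝ := fun i _ =>
    √(budget i / (ε i.castSucc * δ'))
  refine IsCompact.of_isClosed_subset (isCompact_Icc (a := -R) (b := R)) ?_ fun d hd => ?_
  · have : E.fullPower budget = (⋂ i, {d | S.power (E.precoder d) i = budget i}) ∩
        ⋂ i, ⋂ a, ⋂ (_ : E.txRoot i a * E.rcvRoot i.castSucc a = 0), {d | d i a = 0} := by
      ext d
      simp [fullPower]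
    rw [this]
    refine IsClosed.inter (isClosed_iInter fun i => ?_)
      (isClosed_iInter fun i => isClosed_iInter fun a => isClosed_iInter fun _ => ?_)
    · exact isClosed_eq ((continuous_power i).comp E.continuous_precoder) continuous_const
    · exact isClosed_eq (by fun_prop) continuous_const
  · have habs : ∀ i a, |d i a| ≤ R i a := by
      intro i a
      refine Real.abs_le_sqrt ?_
      by_cases hr : E.rcvRoot i.castSucc a = 0
      · rw [hd.2 i a (by rw [hr, mul_zero])]
        have := hb i
        have := hε i.castSucc
        simp only [ne_eq, OfNat.ofNat_ne_zero, not_false_eq_true, zero_pow]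
        positivity
      · rw [le_div_iff₀ (mul_pos (hε _) hδ')]
        have h1 := hδr ⟨i, a⟩ (pow_ne_zero 2 hr)
        simp only at h1
        have h2 : (d i a * E.rcvRoot i.castSucc a) ^ 2 ≤
            frobSq (E.precoder d i * S.rcv i.castSucc) := by
          rw [E.frobSq_precoder_mul_rcv]
          exact Finset.single_le_sum (f := fun a => (d i a * E.rcvRoot i.castSucc a) ^ 2)
            (fun _ _ => sq_nonneg _) (Finset.mem_univ a)
        calc d i a ^ 2 * (ε i.castSucc * δ')
            = ε i.castSucc * (d i a ^ 2 * δ') := by ring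
          _ ≤ S.gain (S.mid (E.precoder d)) i.castSucc * (d i a * E.rcvRoot i.castSucc a) ^ 2 := by
              rw [mul_pow]
              exact mul_le_mul (hεg _ d hd) (mul_le_mul_of_nonneg_left h1 (sq_nonneg _))
                (by positivity) (S.gain_nonneg _ _)
          _ ≤ S.power (E.precoder d) i := mul_le_mul_of_nonneg_left h2 (S.gain_nonneg _ _)
          _ = budget i := hd.1 i
    exact ⟨fun i a => (abs_le.1 (habs i a)).1, fun i a => (abs_le.1 (habs i a)).2⟩

/-- Some aligned precoders maximize the average mutual information. -/
theorem exists_aligned_isMaxOn_averageMI {η : ℝ} (hη : 0 ≤ η) {budget : Fin N → ℝ}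
    (hb : ∀ i, 0 ≤ budget i) :
    ∃ P : S.Precoder, S.Feasible budget P ∧ Aligned E P ∧
      IsMaxOn (S.averageMI η) {Q | S.Feasible budget Q} P := by
  by_cases h : ∃ Q, S.Feasible budget Q ∧ 0 < S.averageMI η Q
  · obtain ⟨Q, hQ, hpos⟩ := h
    -- Some feasible precoder has positive mutual information, hence positive power everywhere.
    have hb' : ∀ i, 0 < budget i := fun i => by
      refine lt_of_lt_of_le (lt_of_le_of_ne (power_nonneg Q i) fun h => ?_)
        ((S.feasible_iff budget Q).1 hQ i)
      rw [averageMI_eq_zero_of_power_eq_zero hη h.symm] at hpos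
      exact lt_irrefl _ hpos
    obtain ⟨d₀, hd₀, hle₀⟩ := E.exists_fullPower_ge hη hQ hpos
    obtain ⟨d, hd, hmax⟩ := (E.isCompact_fullPower hb').exists_isMaxOn ⟨d₀, hd₀⟩
      ((S.continuous_averageMI hη).comp E.continuous_precoder).continuousOn
    refine ⟨E.precoder d, (S.feasible_iff _ _).2 fun i => (hd.1 i).le, E.aligned_precoder d,
      fun Q' hQ' => ?_⟩
    rcases (averageMI_nonneg hη Q').eq_or_lt with h0 | h0
    · change S.averageMI η Q' ≤ _
      rw [← h0]
      exact averageMI_nonneg hη _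
    · obtain ⟨d', hd', hle'⟩ := E.exists_fullPower_ge hη hQ' h0
      exact hle'.trans (hmax hd')
  -- Otherwise all feasible precoders have average zero and the zero precoder is optimal.
  · push Not at h
    refine ⟨E.precoder 0, (S.feasible_iff _ _).2 fun i => ?_, E.aligned_precoder 0,
      fun Q hQ => (h Q hQ).trans (averageMI_nonneg hη _)⟩
    rw [power, E.frobSq_precoder_mul_rcv]
    simpa using hb i

end EigenFrame

end RelayChain

/-! ### Diagonal sequences -/

section Diagonal

lemma exists_tendsto_atTop_comp_le (e : ℕ → ℕ) :
    ∃ c : ℕ → ℕ, Tendsto c atTop atTop ∧ ∀ᶠ n in atTop, e (c n) ≤ n := by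
  -- The largest index `m ≤ n` whose threshold `e m` has been passed; before `e 0` there may be none
  -- and the default `0` is returned, hence only an eventual bound.
  refine ⟨fun n => Nat.findGreatest (fun m => e m ≤ n) n, tendsto_atTop.2 fun m => ?_, ?_⟩
  · filter_upwards [eventually_ge_atTop m, eventually_ge_atTop (e m)] with n h1 h2
    exact Nat.le_findGreatest h1 h2
  · filter_upwards [eventually_ge_atTop (e 0)] with n hn
    exact Nat.findGreatest_spec (P := fun m => e m ≤ n) (Nat.zero_le n) hn

lemma tendsto_diagonal {x : ℕ → ℕ → ℝ} {L : ℕ → ℝ} {M : ℝ} {e c : ℕ → ℕ}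
    (hL : Tendsto L atTop (𝓝 M))
    (hx : ∀ᶠ m in atTop, ∀ n, e m ≤ n → dist (x m n) (L m) < 1 / ((m : ℝ) + 1))
    (hc : Tendsto c atTop atTop) (hec : ∀ᶠ n in atTop, e (c n) ≤ n) :
    Tendsto (fun n => x (c n) n) atTop (𝓝 M) := by
  have h1 : Tendsto (fun n => L (c n)) atTop (𝓝 M) := hL.comp hc
  have h2 : Tendsto (fun n => 1 / ((c n : ℝ) + 1)) atTop (𝓝 0) :=
    tendsto_one_div_add_atTop_nhds_zero_nat.comp hc
  refine h1.congr_dist (squeeze_zero' (Eventually.of_forall fun n => dist_nonneg) ?_ h2)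
  filter_upwards [hc.eventually hx, hec] with n hn he
  rw [dist_comm]
  exact (hn n he).le

lemma exists_diagonal_of_tendsto {x : ℕ → ℕ → ℝ} {L : ℕ → ℝ} {M : ℝ}
    (hL : Tendsto L atTop (𝓝 M)) (hx : ∀ m, Tendsto (x m) atTop (𝓝 (L m))) :
    ∃ c : ℕ → ℕ, Tendsto (fun n => x (c n) n) atTop (𝓝 M) := by
  choose e he using fun m : ℕ =>
    Metric.tendsto_atTop.1 (hx m) (1 / ((m : ℝ) + 1)) Nat.one_div_pos_of_nat
  obtain ⟨c, hc, hec⟩ := exists_tendsto_atTop_comp_le e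
  exact ⟨c, tendsto_diagonal hL (Eventually.of_forall fun m n => he m n) hc hec⟩

/-- The tail events decrease to a null set, so continuity from above applies. -/
lemma exists_measure_tail_lt {Ω : Type*} [MeasurableSpace Ω] {μ : Measure Ω} [IsFiniteMeasure μ]
    {f : ℕ → Ω → ℝ} (hf : ∀ n, Measurable (f n)) {L : ℝ}
    (h : ∀ᵐ ω ∂μ, Tendsto (fun n => f n ω) atTop (𝓝 L)) {δ : ℝ} (hδ : 0 < δ)
    {ε : ENNReal} (hε : 0 < ε) :
    ∃ k, μ {ω | ∃ n, k ≤ n ∧ δ ≤ dist (f n ω) L} < ε := by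
  let B : ℕ → Set Ω := fun k => {ω | ∃ n, k ≤ n ∧ δ ≤ dist (f n ω) L}
  have hB : ∀ k, MeasurableSet (B k) := by
    intro k
    have : B k = ⋃ n, ⋃ (_ : k ≤ n), {ω | δ ≤ dist (f n ω) L} := by
      ext ω; simp [B]
    rw [this]
    exact MeasurableSet.iUnion fun n => MeasurableSet.iUnion fun _ =>
      measurableSet_le measurable_const ((hf n).dist measurable_const)
  have hanti : Antitone B := fun k l hkl ω ⟨n, hn, hd⟩ => ⟨n, hkl.trans hn, hd⟩
  have hz : μ (⋂ k, B k) = 0 := by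
    refine measure_mono_null (fun ω hω => ?_) (ae_iff.1 h)
    intro ht
    obtain ⟨k, hk⟩ := Metric.tendsto_atTop.1 ht δ hδ
    obtain ⟨n, hn, hd⟩ := Set.mem_iInter.1 hω k
    exact absurd (hk n hn) (not_lt.2 hd)
  have ht := tendsto_measure_iInter_atTop (μ := μ) (fun k => (hB k).nullMeasurableSet) hanti
    ⟨0, measure_ne_top μ _⟩
  rw [hz] at ht
  exact (ht.eventually_lt_const hε).exists

/-- The choice `c` must not depend on `ω`. Thresholds with exceptional sets of measure below `2⁻ᵐ`
make it deterministic, and Borel–Cantelli gives convergence almost surely. -/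
lemma exists_diagonal_of_ae_tendsto {Ω : Type*} [MeasurableSpace Ω] {μ : Measure Ω}
    [IsFiniteMeasure μ] {f : ℕ → ℕ → Ω → ℝ} (hf : ∀ m n, Measurable (f m n)) {L : ℕ → ℝ} {M : ℝ}
    (hL : Tendsto L atTop (𝓝 M))
    (h : ∀ m, ∀ᵐ ω ∂μ, Tendsto (fun n => f m n ω) atTop (𝓝 (L m))) :
    ∃ c : ℕ → ℕ, ∀ᵐ ω ∂μ, Tendsto (fun n => f (c n) n ω) atTop (𝓝 M) := by
  choose e he using fun m : ℕ => exists_measure_tail_lt (hf m) (h m)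
    (δ := 1 / ((m : ℝ) + 1)) Nat.one_div_pos_of_nat (ε := (2⁻¹ : ENNReal) ^ m)
    (ENNReal.pow_pos (by simp) m)
  obtain ⟨c, hc, hec⟩ := exists_tendsto_atTop_comp_le e
  refine ⟨c, ?_⟩
  have hsum : ∑' m, μ {ω | ∃ n, e m ≤ n ∧ 1 / ((m : ℝ) + 1) ≤ dist (f m n ω) (L m)} ≠ ⊤ := by
    refine ne_top_of_le_ne_top ?_ (ENNReal.tsum_le_tsum fun m => (he m).le)
    rw [ENNReal.tsum_geometric]
    simp
  filter_upwards [ae_eventually_notMem hsum] with ω hω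
  refine tendsto_diagonal (x := fun m n => f m n ω) hL ?_ hc hec
  filter_upwards [hω] with m hm n hn
  exact not_le.1 fun hd => hm ⟨n, hn, hd⟩

end Diagonal

/-! ### Limits of the mutual information -/

section Asymptotic

variable {N : ℕ} {S : ℕ → RelayChain N} {η : ℝ}

open RelayChain

/-- Because sizes are sampled independently, the joint law of the sequence of mutual informations is
the product of its marginals, which are all that equality of laws at each size controls. -/
lemma HasAsymptoticMI.of_map_eq (hη : 0 ≤ η) {P Q : ∀ n, (S n).Precoder} {L : ℝ}
    (hP : HasAsymptoticMI S η P L)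
    (h : ∀ n, (S n).channelLaw.map ((S n).instMI η (Q n)) =
      (S n).channelLaw.map ((S n).instMI η (P n))) :
    HasAsymptoticMI S η Q L := by
  have key : ∀ R : ∀ n, (S n).Precoder, HasAsymptoticMI S η R L ↔
      ∀ᵐ x ∂(Measure.infinitePi fun n => (S n).channelLaw.map ((S n).instMI η (R n))),
        Tendsto x atTop (𝓝 L) := by
    intro R
    have hm : Measurable fun (θ : ∀ n, (S n).Sample) n => (S n).instMI η (R n) (θ n) :=
      measurable_pi_lambda _ fun n => (measurable_instMI hη (R n)).comp (measurable_pi_apply n)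
    rw [← Measure.infinitePi_map_pi _ fun n => measurable_instMI hη (R n),
      ae_map_iff hm.aemeasurable]
    · rfl
    · exact measurableSet_tendsto (𝓝 L) fun n => measurable_pi_apply n
  rw [key] at hP ⊢
  simpa only [h] using hP

lemma HasAsymptoticAverageMI.of_map_eq (hη : 0 ≤ η) {P Q : ∀ n, (S n).Precoder} {L : ℝ}
    (hP : HasAsymptoticAverageMI S η P L)
    (h : ∀ n, (S n).channelLaw.map ((S n).instMI η (Q n)) =
      (S n).channelLaw.map ((S n).instMI η (P n))) :
    HasAsymptoticAverageMI S η Q L :=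
  hP.congr fun n => (averageMI_eq_of_map_eq hη (h n)).symm

lemma averageMI_eq_integral_infinitePi (hη : 0 ≤ η) (P : ∀ n, (S n).Precoder) (n : ℕ) :
    Integrable (fun θ : ∀ n, (S n).Sample => (S n).instMI η (P n) (θ n))
      (Measure.infinitePi fun n => (S n).channelLaw) ∧
    ∫ θ, (S n).instMI η (P n) (θ n) ∂(Measure.infinitePi fun n => (S n).channelLaw) =
      (S n).averageMI η (P n) := by
  have hm := measurePreserving_eval_infinitePi (fun n => (S n).channelLaw) n
  have hi := (S n).integrable_instMI hη (P n)
  refine ⟨hm.integrable_comp_of_integrable hi, ?_⟩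
  rw [averageMI, ← hm.map_eq, integral_map hm.measurable.aemeasurable]
  exact (measurable_instMI hη (P n)).aestronglyMeasurable

/-- The average mutual information is asymptotically at least the almost sure limit. -/
lemma HasAsymptoticMI.eventually_lt_averageMI (hη : 0 ≤ η) {P : ∀ n, (S n).Precoder} {L : ℝ}
    (hP : HasAsymptoticMI S η P L) {c : ℝ} (hc : c < L) :
    ∀ᶠ n in atTop, c < (S n).averageMI η (P n) := by
  rcases lt_or_ge c 0 with h0 | h0
  · exact Eventually.of_forall fun n => h0.trans_le (averageMI_nonneg hη _)
  have hL : 0 ≤ L := h0.trans hc.le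
  have hmeas : ∀ n, Measurable fun θ : ∀ n, (S n).Sample => (S n).instMI η (P n) (θ n) :=
    fun n => (measurable_instMI hη (P n)).comp (measurable_pi_apply n)
  -- Truncation at `L` provides the majorant without any uniform integrability of the mutual
  -- informations; it gives a lower bound on the averages only.
  have hlim := tendsto_integral_of_dominated_convergence
    (μ := Measure.infinitePi fun n => (S n).channelLaw)
    (F := fun n θ => min ((S n).instMI η (P n) (θ n)) L) (f := fun _ => L) (fun _ => L)
    (fun n => ((hmeas n).min measurable_const).aestronglyMeasurable) (integrable_const _)
    (fun n => ae_of_all _ fun θ => by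
      rw [Real.norm_of_nonneg (le_min ((S n).instMI_nonneg hη _ _) hL)]
      exact min_le_right _ _)
    (by
      filter_upwards [hP] with θ hθ
      simpa using hθ.min (tendsto_const_nhds (x := L)))
  rw [integral_const, probReal_univ, one_smul] at hlim
  filter_upwards [hlim.eventually_const_lt hc] with n hn
  obtain ⟨hi, he⟩ := averageMI_eq_integral_infinitePi hη P n
  rw [← he]
  refine hn.trans_le (integral_mono_of_nonneg ?_ hi ?_)
  · exact ae_of_all _ fun θ => le_min ((S n).instMI_nonneg hη _ _) hL
  · exact ae_of_all _ fun θ => min_le_left _ _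

/-- A notion of asymptotic mutual information for which alignment loses nothing, the zero precoders
have a value, and which is closed under diagonal sequences has optimal aligned sequences. -/
lemma alignedOptimal_of_diagonal {budget : ℕ → Fin N → ℝ} {E : ∀ n, (S n).EigenFrame}
    {A : (∀ n, (S n).Precoder) → ℝ → Prop}
    (halign : ∀ P L, (∀ n, (S n).Feasible (budget n) (P n)) → A P L →
      L ∈ alignedMI S budget E A)
    (hne : (attainableMI S budget A).Nonempty)
    (hdiag : ∀ (P : ℕ → ∀ n, (S n).Precoder) (L : ℕ → ℝ) (M : ℝ), Tendsto L atTop (𝓝 M) →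
      (∀ m, A (P m) (L m)) → ∃ c : ℕ → ℕ, A (fun n => P (c n) n) M) :
    AlignedOptimal S budget E A := by
  refine ⟨fun L ⟨P, hP, hA⟩ => ⟨L, halign P L hP hA, le_rfl⟩, fun hb => ?_⟩
  -- Attainable values approach the supremum; a diagonal of their precoder sequences attains it and
  -- is aligned afterwards.
  obtain ⟨u, -, hu, hmem⟩ := exists_seq_tendsto_sSup hne hb
  choose P hP hA using hmem
  obtain ⟨c, hc⟩ := hdiag P u _ hu hA
  have hfeas : ∀ n, (S n).Feasible (budget n) (P (c n) n) := fun n => hP (c n) n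
  exact ⟨_, halign _ _ hfeas hc, ⟨_, hfeas, hc⟩, fun L hL => le_csSup hb hL⟩

end Asymptotic

/-! ### Asymptotic optimality of alignment -/

section Optimality

variable {N : ℕ} {S : ℕ → RelayChain N} {η : ℝ} {budget : ℕ → Fin N → ℝ}

open RelayChain

lemma exists_aligned_sequence (hη : 0 ≤ η) (E : ∀ n, (S n).EigenFrame) {P : ∀ n, (S n).Precoder}
    (hP : ∀ n, (S n).Feasible (budget n) (P n)) :
    ∃ Q : ∀ n, (S n).Precoder, (∀ n, (S n).Feasible (budget n) (Q n)) ∧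
      (∀ n, Aligned (E n) (Q n)) ∧
      ∀ n, (S n).channelLaw.map ((S n).instMI η (Q n)) =
        (S n).channelLaw.map ((S n).instMI η (P n)) := by
  choose d _ hle hlaw using fun n => (E n).exists_aligned_same_law hη (P n)
  exact ⟨fun n => (E n).precoder (d n),
    fun n => ((S n).feasible_iff _ _).2 fun i =>
      (hle n i).trans (((S n).feasible_iff _ _).1 (hP n) i),
    fun n => (E n).aligned_precoder _, hlaw⟩

lemma power_zero (S : RelayChain N) (i : Fin N) : S.power 0 i = 0 := by
  simp [power, frobSq_eq_zero_iff.2]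

lemma feasible_zero {S : RelayChain N} {budget : Fin N → ℝ} (hb : ∀ i, 0 ≤ budget i) :
    S.Feasible budget 0 :=
  (S.feasible_iff _ _).2 fun i => (power_zero S i).trans_le (hb i)

lemma alignedOptimal_hasAsymptoticMI (hN : 1 ≤ N) (hη : 0 ≤ η) (hb : ∀ n i, 0 ≤ budget n i)
    (E : ∀ n, (S n).EigenFrame) : AlignedOptimal S budget E (HasAsymptoticMI S η) := by
  refine alignedOptimal_of_diagonal (fun P L hP hA => ?_)
    ⟨0, fun n => 0, fun n => feasible_zero (hb n), ?_⟩ fun P L M hL hA => ?_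
  · obtain ⟨Q, hQ, hal, hlaw⟩ := exists_aligned_sequence hη E hP
    exact ⟨Q, hQ, hal, hA.of_map_eq hη hlaw⟩
  · refine ae_of_all _ fun θ => ?_
    simp_rw [instMI_eq_zero_of_power_eq_zero hη (power_zero _ ⟨0, hN⟩)]
    exact tendsto_const_nhds
  · exact exists_diagonal_of_ae_tendsto
      (f := fun m n (θ : ∀ n, (S n).Sample) => (S n).instMI η (P m n) (θ n))
      (fun m n => (measurable_instMI hη (P m n)).comp (measurable_pi_apply n)) hL hA

lemma alignedOptimal_hasAsymptoticAverageMI (hN : 1 ≤ N) (hη : 0 ≤ η)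
    (hb : ∀ n i, 0 ≤ budget n i) (E : ∀ n, (S n).EigenFrame) :
    AlignedOptimal S budget E (HasAsymptoticAverageMI S η) := by
  refine alignedOptimal_of_diagonal (fun P L hP hA => ?_)
    ⟨0, fun n => 0, fun n => feasible_zero (hb n), ?_⟩ fun P L M hL hA => ?_
  · obtain ⟨Q, hQ, hal, hlaw⟩ := exists_aligned_sequence hη E hP
    exact ⟨Q, hQ, hal, hA.of_map_eq hη hlaw⟩
  · unfold HasAsymptoticAverageMI
    simp_rw [averageMI_eq_zero_of_power_eq_zero hη (power_zero _ ⟨0, hN⟩)]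
    exact tendsto_const_nhds
  · exact exists_diagonal_of_tendsto (x := fun m n => (S n).averageMI η (P m n)) hL hA

end Optimality

end

theorem theorem5 (N : ℕ) (hN : 1 ≤ N) (η : ℝ) (hη : 0 < η) :
    -- finite size
    (∀ (S : RelayChain N) (budget : Fin N → ℝ), (∀ i, 0 ≤ budget i) → ∀ E : S.EigenFrame,
      ∃ P : S.Precoder, S.Feasible budget P ∧ RelayChain.Aligned E P ∧
        IsMaxOn (S.averageMI η) {Q | S.Feasible budget Q} P) ∧
    -- asymptotic regime
    (∀ (S : ℕ → RelayChain N) (ρ : Fin (N + 1) → ℝ) (budget : ℕ → Fin N → ℝ),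
      (∀ j, Tendsto (fun n => (S n).k j) atTop atTop) →
      (∀ j, Tendsto (fun n => ((S n).k j : ℝ) / ((S n).k (Fin.last N) : ℝ)) atTop (𝓝 (ρ j))) →
      (∀ n i, 0 ≤ budget n i) → ∀ E : ∀ n, (S n).EigenFrame,
      AlignedOptimal S budget E (HasAsymptoticMI S η) ∧
      AlignedOptimal S budget E (HasAsymptoticAverageMI S η) ∧
      -- finite-size optimal aligned precoders are also asymptotically optimal
      ∃ P : ∀ n, (S n).Precoder,
        (∀ n, (S n).Feasible (budget n) (P n) ∧ RelayChain.Aligned (E n) (P n) ∧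
          IsMaxOn ((S n).averageMI η) {Q | (S n).Feasible (budget n) Q} (P n)) ∧
        ∀ L ∈ attainableMI S budget (HasAsymptoticMI S η) ∪
            attainableMI S budget (HasAsymptoticAverageMI S η),
          ∀ c < L, ∀ᶠ n in atTop, c < (S n).averageMI η (P n)) := by
  refine ⟨fun S budget hb E => E.exists_aligned_isMaxOn_averageMI hη.le hb,
    fun S _ budget _ _ hb E => ⟨alignedOptimal_hasAsymptoticMI hN hη.le hb E,
      alignedOptimal_hasAsymptoticAverageMI hN hη.le hb E, ?_⟩⟩
  choose P hP using fun n => (E n).exists_aligned_isMaxOn_averageMI hη.le (hb n)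
  refine ⟨P, hP, fun L hL c hc => ?_⟩
  rcases hL with ⟨Q, hQ, hA⟩ | ⟨Q, hQ, hA⟩
  · filter_upwards [hA.eventually_lt_averageMI hη.le hc] with n hn
    exact hn.trans_le ((hP n).2.2 (hQ n))
  · filter_upwards [hA.eventually_const_lt hc] with n hn
    exact hn.trans_le ((hP n).2.2 (hQ n))
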